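/- Let $H^2$ be the Hardy space of the open unit disk $\mathbb{D}$, with inner product $\langle f,h\rangle=\frac1{2\pi}\int_0^{2\pi} f(e^{i\theta})\overline{h(e^{i\theta})}\,d\theta$ (functions in $H^2$ are identified with their boundary functions), and let $H^\infty$ be the algebra of bounded analytic functions on $\mathbb{D}$. Let $N^+_{\mathbb{R}}$ be the set of Smirnov functions $g=u/v$ ($u,v\in H^\infty$, $v$ outer) that are real-valued almost everywhere on the unit circle. The canonical representation of a Smirnov function $g$ is $g=b/a$ with $a,b\in H^\infty$, $a$ outer, $a(0)>0$ and $|a|^2+|b|^2=1$ almost everywhere on the circle; the Toeplitz operator $T_g$ is the (in general unbounded) operator in $H^2$ with domain $aH^2$ given by $T_gf=gf$. **Proposition.** Let $g\in N^+_{\mathbb{R}}$ and let $B$ be a finite Blaschke product of order $n\ge 1$. Then $g$ and $g\circ B$ have canonical representations, so that $T_g$ and $T_{g\circ B}$ are defined, and $T_{g\circ B}$ is unitarily equivalent to the $n$-fold direct sum $\bigoplus_n T_g$. More precisely, $(BH^2)^\perp$ has dimension $n$, and for every orthonormal basis $\{w_1,\dots,w_n\}$ of $(BH^2)^\perp$ the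 formula $$U\Big(\bigoplus_{j=1}^n f_j\Big)=\sum_{j=1}^n w_j\,(f_j\circ B)$$ defines a unitary operator $U:\bigoplus_n H^2\to H^2$ that maps the domain $\bigoplus_n aH^2$ of $\bigoplus_n T_g$ (where $g=b/a$ is the canonical representation) onto the domain of $T_{g\circ B}$ and satisfies $U\big(\bigoplus_n T_g\big)=T_{g\circ B}\,U$ there. -/

import Mathlib

open MeasureTheory AddCircle Filter Topology

/-! The unit circle is parametrized by `UnitAddCircle = ℝ / ℤ` through `t ↦ toCircle t = e^{2πit}`;
`haarAddCircle` is normalized arc length, i.e. `dθ / 2π`. -/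

/-- The Hardy space `H²`, as the Hilbert space of boundary functions: the functions in `L²` of the
circle (normalized arc length) all of whose Fourier coefficients of negative index vanish. -/
noncomputable def Hardy2 : Submodule ℂ (Lp ℂ 2 (haarAddCircle : Measure UnitAddCircle)) where
  carrier := {f | ∀ k : ℤ, k < 0 → fourierCoeff f k = 0}
  zero_mem' := by
    intro k _
    rw [← fourierBasis_repr]; simp
  add_mem' := by
    intro f g hf hg k hk
    have h1 := hf k hk
    have h2 := hg k hk
    rw [← fourierBasis_repr] at h1 h2 ⊢
    simp [h1, h2]
  smul_mem' := by
    intro c f hf k hk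
    have h1 := hf k hk
    rw [← fourierBasis_repr] at h1 ⊢
    simp [h1]

namespace Hardy2

/-- The analytic function on the open unit disk given by an element of `H²`: its Taylor
coefficients at `0` are the Fourier coefficients of the boundary function. -/
noncomputable def eval (f : Hardy2) (z : ℂ) : ℂ :=
  ∑' k : ℕ, fourierCoeff (f : Lp ℂ 2 (haarAddCircle : Measure UnitAddCircle)) (k : ℤ) * z ^ k

/-- The `k`-th Taylor coefficient, as a linear functional. -/
noncomputable def coeff (k : ℕ) : Hardy2 →ₗ[ℂ] ℂ where
  toFun f := fourierCoeff (f : Lp ℂ 2 (haarAddCircle : Measure UnitAddCircle)) (k : ℤ)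
  map_add' f g := by simp only [← fourierBasis_repr]; simp
  map_smul' c f := by simp only [← fourierBasis_repr]; simp

theorem summable_sq (f : Hardy2) : Summable fun k : ℕ => ‖coeff k f‖ ^ 2 :=
  (hasSum_sq_fourierCoeff
    (f : Lp ℂ 2 (haarAddCircle : Measure UnitAddCircle))).summable.comp_injective
      Nat.cast_injective

theorem exists_coeff_bound (f : Hardy2) : ∃ C, ∀ k, ‖coeff k f‖ ≤ C := by
  refine ⟨√(∑' k : ℕ, ‖coeff k f‖ ^ 2), fun k => Real.le_sqrt_of_sq_le ?_⟩
  exact (summable_sq f).le_tsum k fun j _ => by positivity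

theorem summable_norm (f : Hardy2) {z : ℂ} (hz : ‖z‖ < 1) :
    Summable fun k : ℕ => ‖coeff k f * z ^ k‖ := by
  obtain ⟨C, hC⟩ := exists_coeff_bound f
  refine Summable.of_nonneg_of_le (fun _ => norm_nonneg _) (fun k => ?_)
    ((summable_geometric_of_lt_one (norm_nonneg z) hz).mul_left C)
  rw [norm_mul, norm_pow]
  gcongr
  exact hC k

theorem hasSum_eval (f : Hardy2) {z : ℂ} (hz : ‖z‖ < 1) :
    HasSum (fun k : ℕ => coeff k f * z ^ k) (eval f z) :=
  (summable_norm f hz).of_norm.hasSum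

theorem eval_add (f g : Hardy2) {z : ℂ} (hz : ‖z‖ < 1) :
    eval (f + g) z = eval f z + eval g z := by
  refine (hasSum_eval (f + g) hz).unique ?_
  simpa [add_mul] using (hasSum_eval f hz).add (hasSum_eval g hz)

theorem eval_smul (c : ℂ) (f : Hardy2) {z : ℂ} (hz : ‖z‖ < 1) :
    eval (c • f) z = c * eval f z := by
  refine (hasSum_eval (c • f) hz).unique ?_
  simpa [mul_assoc] using (hasSum_eval f hz).mul_left c

theorem eval_zero (z : ℂ) : eval 0 z = 0 := by
  have h : ∀ k : ℕ, fourierCoeff ((0 : Hardy2) : Lp ℂ 2 (haarAddCircle : Measure UnitAddCircle))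
      (k : ℤ) = 0 := fun k => (coeff k).map_zero
  simp only [eval, h, zero_mul, tsum_zero]

theorem hasFPowerSeriesAt_eval (f : Hardy2) :
    HasFPowerSeriesAt (eval f) (FormalMultilinearSeries.ofScalars ℂ fun k => coeff k f) 0 := by
  rw [hasFPowerSeriesAt_iff]
  filter_upwards [Metric.ball_mem_nhds (0 : ℂ) one_pos] with z hz
  rw [mem_ball_zero_iff] at hz
  simpa [FormalMultilinearSeries.coeff_ofScalars, mul_comm] using hasSum_eval f hz

/-- An element of `H²` is determined by its analytic function on the disk. -/
theorem ext_eval {f g : Hardy2} (h : ∀ z : ℂ, ‖z‖ < 1 → eval f z = eval g z) : f = g := by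
  have hp : HasFPowerSeriesAt (eval f)
      (FormalMultilinearSeries.ofScalars ℂ fun k => coeff k g) 0 := by
    refine (hasFPowerSeriesAt_eval g).congr ?_
    filter_upwards [Metric.ball_mem_nhds (0 : ℂ) one_pos] with z hz
    rw [mem_ball_zero_iff] at hz
    exact (h z hz).symm
  have he := (hasFPowerSeriesAt_eval f).eq_formalMultilinearSeries hp
  have hc : ∀ k, coeff k f = coeff k g := fun k => by
    have := congrArg (fun p => FormalMultilinearSeries.coeff p k) he
    simpa [FormalMultilinearSeries.coeff_ofScalars] using this
  apply Subtype.ext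
  apply fourierBasis.repr.injective
  ext k
  rw [fourierBasis_repr, fourierBasis_repr]
  rcases lt_or_ge k 0 with hk | hk
  · rw [f.2 k hk, g.2 k hk]
  · lift k to ℕ using hk
    exact hc k

/-- The analytic function of an element of `H²` is holomorphic on the disk. -/
theorem differentiableOn_eval (f : Hardy2) :
    DifferentiableOn ℂ (eval f) (Metric.ball 0 1) := by
  intro z hz
  rw [mem_ball_zero_iff] at hz
  obtain ⟨r, hr, hr1⟩ := exists_between hz
  have hr0 : 0 ≤ r := (norm_nonneg z).trans hr.le
  have hs := summable_norm f (z := (r : ℂ)) (by simpa [abs_of_nonneg hr0] using hr1)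
  have : DifferentiableOn ℂ (eval f) (Metric.ball 0 r) := by
    refine Complex.differentiableOn_tsum_of_summable_norm hs (fun k => by fun_prop) Metric.isOpen_ball ?_
    intro k w hw
    rw [mem_ball_zero_iff] at hw
    change ‖coeff k f * w ^ k‖ ≤ _
    rw [norm_mul, norm_mul, norm_pow, norm_pow, Complex.norm_real, Real.norm_of_nonneg hr0]
    gcongr
  exact (this.differentiableAt (Metric.isOpen_ball.mem_nhds (by simpa using hr)))
    |>.differentiableWithinAt

/-- Every square-summable sequence is the sequence of Taylor coefficients of an element of `H²`. -/
theorem exists_of_summable_sq (c : ℕ → ℂ) (hc : Summable fun k => ‖c k‖ ^ 2) :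
    ∃ f : Hardy2, ∀ k, coeff k f = c k := by
  let d : ℤ → ℂ := fun k => if 0 ≤ k then c k.toNat else 0
  have hd : Memℓp d 2 := by
    apply memℓp_gen
    have : Summable fun k : ℤ => ‖d k‖ ^ 2 := by
      refine (Function.Injective.summable_iff (Nat.cast_injective (R := ℤ)) ?_).1 ?_
      · intro k hk
        have : ¬ 0 ≤ k := fun h => hk ⟨k.toNat, by simp [h]⟩
        simp [d, this]
      · simpa [d, Function.comp_def] using hc
    simpa using this
  let F : Lp ℂ 2 (haarAddCircle : Measure UnitAddCircle) := fourierBasis.repr.symm ⟨d, hd⟩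
  have hF : ∀ k : ℤ, fourierCoeff F k = d k := fun k => by
    rw [← fourierBasis_repr]; simp [F]
  refine ⟨⟨F, fun k hk => ?_⟩, fun k => ?_⟩
  · rw [hF]; simp [d, not_le.2 hk]
  · change fourierCoeff F k = c k
    rw [hF]; simp [d]

/-- Parseval's identity for absolutely convergent power series on the circle. -/
theorem exists_continuous_of_summable (c : ℕ → ℂ) (hc : Summable fun k => ‖c k‖) :
    ∃ S : C(UnitAddCircle, ℂ), (∀ t, HasSum (fun k : ℕ => c k * (toCircle t : ℂ) ^ k) (S t)) ∧
      HasSum (fun k => ‖c k‖ ^ 2) (‖ContinuousMap.toLp (E := ℂ) 2 haarAddCircle ℂ S‖ ^ 2) := by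
  have hs : Summable fun k : ℕ => c k • (fourier (k : ℤ) : C(UnitAddCircle, ℂ)) := by
    apply Summable.of_norm
    simpa [norm_smul, fourier_norm] using hc
  refine ⟨∑' k : ℕ, c k • (fourier (k : ℤ) : C(UnitAddCircle, ℂ)), fun t => ?_, ?_⟩
  · have := (ContinuousMap.evalCLM ℂ t).hasSum hs.hasSum
    simpa [Function.comp_def, toCircle_nsmul] using this
  · have h1 := (ContinuousMap.toLp (E := ℂ) 2 (haarAddCircle : Measure UnitAddCircle) ℂ).hasSum
      hs.hasSum
    have h2 := ((h1.tendsto_sum_nat).norm).pow 2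
    rw [(hasSum_iff_tendsto_nat_of_nonneg (fun _ => by positivity) _)]
    refine h2.congr fun N => ?_
    have ho : Orthonormal ℂ fun k : ℕ =>
        (fourierLp 2 (k : ℤ) : Lp ℂ 2 (haarAddCircle : Measure UnitAddCircle)) :=
      orthonormal_fourier.comp _ Nat.cast_injective
    have h3 := ho.inner_sum c c (Finset.range N)
    have h4 : (fun k : ℕ => (ContinuousMap.toLp (E := ℂ) 2
        (haarAddCircle : Measure UnitAddCircle) ℂ) (c k • fourier (k : ℤ))) =
        fun k : ℕ => c k • fourierLp 2 (k : ℤ) := by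
      funext k; simp
    rw [h4]
    rw [inner_self_eq_norm_sq_to_K] at h3
    have h5 : ∀ x : ℂ, (starRingEnd ℂ) x * x = ((‖x‖ ^ 2 : ℝ) : ℂ) := fun x => by
      rw [Complex.conj_mul']; norm_cast
    simp only [h5] at h3
    rw [← Complex.ofReal_sum] at h3
    exact Complex.ofReal_injective (by simpa using h3.symm) |>.symm

/-- Multiplication by a bounded analytic function maps `H²` into `H²`. -/
theorem exists_mul (φ : ℂ → ℂ) (hφ : DifferentiableOn ℂ φ (Metric.ball 0 1))
    (hb : ∃ M : ℝ, ∀ z ∈ Metric.ball (0 : ℂ) 1, ‖φ z‖ ≤ M) (h : Hardy2) :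
    ∃ k : Hardy2, ∀ z : ℂ, ‖z‖ < 1 → eval k z = φ z * eval h z := by
  obtain ⟨M, hM⟩ := hb
  have hM0 : 0 ≤ M := (norm_nonneg _).trans (hM 0 (by simp))
  have hF := hφ.mul (differentiableOn_eval h)
  let c : ℕ → ℂ := fun k =>
    ((k.factorial : ℂ))⁻¹ * iteratedDeriv k (φ * eval h) 0
  have hc : ∀ z : ℂ, ‖z‖ < 1 → HasSum (fun k => c k * z ^ k) (φ z * eval h z) := by
    intro z hz
    have := Complex.hasSum_taylorSeries_on_ball hF (z := z) (by simpa using hz)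
    have he : (fun k => c k * z ^ k) = fun k : ℕ =>
        ((k.factorial : ℂ))⁻¹ • (z - 0) ^ k • iteratedDeriv k (φ * eval h) 0 := by
      funext k
      simp [c]; ring
    rw [he]
    exact this
  have key : ∀ r : ℝ, 0 ≤ r → r < 1 → ∀ N, ∑ k ∈ Finset.range N, ‖c k * (r : ℂ) ^ k‖ ^ 2 ≤
      M ^ 2 * ∑' k, ‖coeff k h‖ ^ 2 := by
    intro r hr0 hr1 N
    have hrn : ‖(r : ℂ)‖ < 1 := by simpa [abs_of_nonneg hr0] using hr1
    obtain ⟨S, hS1, hS2⟩ := exists_continuous_of_summable (fun k => c k * (r : ℂ) ^ k)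
      (hc r hrn).summable.norm
    obtain ⟨R, hR1, hR2⟩ := exists_continuous_of_summable (fun k => coeff k h * (r : ℂ) ^ k)
      (summable_norm h hrn)
    have hzt : ∀ t : UnitAddCircle, ‖(r : ℂ) * (toCircle t : ℂ)‖ < 1 := by
      intro t; rw [norm_mul, Circle.norm_coe, mul_one]; exact hrn
    have hSt : ∀ t, S t = φ (r * toCircle t) * eval h (r * toCircle t) := fun t =>
      (hS1 t).unique (by simpa [mul_pow, mul_assoc] using hc _ (hzt t))
    have hRt : ∀ t, R t = eval h (r * toCircle t) := fun t =>
      (hR1 t).unique (by simpa [mul_pow, mul_assoc] using hasSum_eval h (hzt t))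
    have hle : ‖ContinuousMap.toLp (E := ℂ) 2 (haarAddCircle : Measure UnitAddCircle) ℂ S‖ ≤
        M * ‖ContinuousMap.toLp (E := ℂ) 2 (haarAddCircle : Measure UnitAddCircle) ℂ R‖ := by
      apply Lp.norm_le_mul_norm_of_ae_le_mul
      filter_upwards [ContinuousMap.coeFn_toLp (p := 2) (𝕜 := ℂ)
        (haarAddCircle : Measure UnitAddCircle) S,
        ContinuousMap.coeFn_toLp (p := 2) (𝕜 := ℂ)
        (haarAddCircle : Measure UnitAddCircle) R] with t h1 h2
      rw [h1, h2, hSt, hRt, norm_mul]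
      gcongr
      exact hM _ (by simpa using hzt t)
    calc ∑ k ∈ Finset.range N, ‖c k * (r : ℂ) ^ k‖ ^ 2
        ≤ _ := sum_le_hasSum _ (fun _ _ => by positivity) hS2
      _ ≤ (M * ‖ContinuousMap.toLp (E := ℂ) 2
            (haarAddCircle : Measure UnitAddCircle) ℂ R‖) ^ 2 := by gcongr
      _ = M ^ 2 * ∑' k, ‖coeff k h * (r : ℂ) ^ k‖ ^ 2 := by rw [mul_pow, hR2.tsum_eq]
      _ ≤ M ^ 2 * ∑' k, ‖coeff k h‖ ^ 2 := by
          refine mul_le_mul_of_nonneg_left ?_ (sq_nonneg M)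
          refine Summable.tsum_le_tsum (fun k => ?_) hR2.summable (summable_sq h)
          gcongr
          rw [norm_mul, norm_pow]
          exact mul_le_of_le_one_right (norm_nonneg _) (pow_le_one₀ (norm_nonneg _) hrn.le)
  have hsum : Summable fun k => ‖c k‖ ^ 2 := by
    refine summable_of_sum_range_le (c := M ^ 2 * ∑' k, ‖coeff k h‖ ^ 2)
      (fun _ => by positivity) fun N => ?_
    have hcont : Tendsto (fun r : ℝ => ∑ k ∈ Finset.range N, ‖c k * (r : ℂ) ^ k‖ ^ 2) (𝓝[<] 1)
        (𝓝 (∑ k ∈ Finset.range N, ‖c k * ((1 : ℝ) : ℂ) ^ k‖ ^ 2)) := by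
      refine Tendsto.mono_left (Continuous.tendsto ?_ 1) nhdsWithin_le_nhds
      fun_prop
    have := le_of_tendsto hcont (b := M ^ 2 * ∑' k, ‖coeff k h‖ ^ 2) (by
      filter_upwards [Ioo_mem_nhdsLT (zero_lt_one (α := ℝ))] with r hr
      exact key r hr.1.le hr.2 N)
    simpa using this
  obtain ⟨k, hk⟩ := exists_of_summable_sq c hsum
  refine ⟨k, fun z hz => (hasSum_eval k hz).unique ?_⟩
  simpa [hk] using hc z hz

/-- `φ H²`: the elements of `H²` of the form `φ h` with `h ∈ H²`. -/
noncomputable def mulRange (φ : ℂ → ℂ) : Submodule ℂ Hardy2 where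
  carrier := {f | ∃ h : Hardy2, ∀ z : ℂ, ‖z‖ < 1 → eval f z = φ z * eval h z}
  zero_mem' := ⟨0, fun z _ => by simp [eval_zero]⟩
  add_mem' := by
    rintro f g ⟨h, hh⟩ ⟨k, hk⟩
    exact ⟨h + k, fun z hz => by rw [eval_add _ _ hz, eval_add _ _ hz, hh z hz, hk z hz]; ring⟩
  smul_mem' := by
    rintro c f ⟨h, hh⟩
    exact ⟨c • h, fun z hz => by rw [eval_smul _ _ hz, eval_smul _ _ hz, hh z hz]; ring⟩

end Hardy2

/-- `φ ∈ H^∞`: bounded and analytic on the open unit disk. (Functions on the disk are represented by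
functions `ℂ → ℂ`, whose values outside the disk play no role.) -/
def IsHInfty (φ : ℂ → ℂ) : Prop :=
  DifferentiableOn ℂ φ (Metric.ball 0 1) ∧ ∃ M : ℝ, ∀ z ∈ Metric.ball (0 : ℂ) 1, ‖φ z‖ ≤ M

/-- `φ` is an outer function on the disk:
`φ(z) = c exp (∫ (ζ + z) / (ζ - z) k(ζ) dm(ζ))` with `|c| = 1`, `k` real-valued and integrable
(`k` is then the logarithm of the modulus of the boundary function of `φ`). -/
def IsOuter (φ : ℂ → ℂ) : Prop :=
  ∃ (c : ℂ) (k : UnitAddCircle → ℝ), ‖c‖ = 1 ∧ Integrable k haarAddCircle ∧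
    ∀ z ∈ Metric.ball (0 : ℂ) 1, φ z = c * Complex.exp
      (∫ t, (((toCircle t : ℂ) + z) / ((toCircle t : ℂ) - z)) * (k t : ℂ) ∂haarAddCircle)

/-- `l` is the radial boundary value of `φ` at the point of the circle with parameter `t`. -/
def HasRadialLimit (φ : ℂ → ℂ) (t : UnitAddCircle) (l : ℂ) : Prop :=
  Tendsto (fun r : ℝ => φ (r * (toCircle t : ℂ))) (𝓝[<] 1) (𝓝 l)

/-- The Smirnov class `N⁺`: quotients of bounded analytic functions with outer denominator. -/
def IsSmirnov (g : ℂ → ℂ) : Prop :=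
  ∃ u v : ℂ → ℂ, IsHInfty u ∧ IsHInfty v ∧ IsOuter v ∧
    ∀ z ∈ Metric.ball (0 : ℂ) 1, g z = u z / v z

/-- The class `N⁺_ℝ` of Smirnov functions that are real-valued almost everywhere on the circle. -/
def IsRealSmirnov (g : ℂ → ℂ) : Prop :=
  IsSmirnov g ∧ ∀ᵐ t : UnitAddCircle ∂haarAddCircle, ∃ x : ℝ, HasRadialLimit g t (x : ℂ)

/-- `g = b / a` is the canonical representation of the Smirnov function `g`: `a, b ∈ H^∞`, `a` is
outer, `a(0) > 0`, and `|a|² + |b|² = 1` almost everywhere on the circle. -/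
structure IsCanonicalPair (g a b : ℂ → ℂ) : Prop where
  hInfty_a : IsHInfty a
  hInfty_b : IsHInfty b
  outer_a : IsOuter a
  pos_a : ∃ x : ℝ, 0 < x ∧ a 0 = (x : ℂ)
  sq_add_sq : ∀ᵐ t : UnitAddCircle ∂haarAddCircle, ∃ α β : ℂ,
    HasRadialLimit a t α ∧ HasRadialLimit b t β ∧ ‖α‖ ^ 2 + ‖β‖ ^ 2 = 1
  eq_div : ∀ z ∈ Metric.ball (0 : ℂ) 1, g z = b z / a z

theorem IsOuter.ne_zero {φ : ℂ → ℂ} (h : IsOuter φ) {z : ℂ} (hz : ‖z‖ < 1) : φ z ≠ 0 := by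
  obtain ⟨c, k, hc, -, h⟩ := h
  rw [h z (by simpa using hz)]
  refine mul_ne_zero (fun h0 => ?_) (Complex.exp_ne_zero _)
  simp [h0] at hc

/-- If `g = b / a` is the canonical representation of `g`, then `g f ∈ H²` for `f ∈ a H²`. -/
theorem IsCanonicalPair.exists_mul {g a b : ℂ → ℂ} (hp : IsCanonicalPair g a b)
    (f : Hardy2.mulRange a) :
    ∃ k : Hardy2, ∀ z : ℂ, ‖z‖ < 1 → Hardy2.eval k z = g z * Hardy2.eval f z := by
  obtain ⟨f, h, hh⟩ := f
  obtain ⟨k, hk⟩ := Hardy2.exists_mul b hp.hInfty_b.1 hp.hInfty_b.2 h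
  refine ⟨k, fun z hz => ?_⟩
  have ha := hp.outer_a.ne_zero hz
  rw [hk z hz, hp.eq_div z (by simpa using hz), hh z hz]
  field_simp

/-- The Toeplitz operator `T_g` for a Smirnov function `g` with canonical representation
`g = b / a`: its domain is `a H²`, and `T_g f = g f`. -/
noncomputable def toeplitz {g a b : ℂ → ℂ} (hp : IsCanonicalPair g a b) : Hardy2 →ₗ.[ℂ] Hardy2 where
  domain := Hardy2.mulRange a
  toFun :=
    { toFun := fun f => (hp.exists_mul f).choose
      map_add' := fun f h => Hardy2.ext_eval fun z hz => by
        rw [Hardy2.eval_add _ _ hz, (hp.exists_mul (f + h)).choose_spec z hz,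
          (hp.exists_mul f).choose_spec z hz, (hp.exists_mul h).choose_spec z hz,
          Submodule.coe_add, Hardy2.eval_add _ _ hz]
        ring
      map_smul' := fun c f => Hardy2.ext_eval fun z hz => by
        rw [RingHom.id_apply, Hardy2.eval_smul _ _ hz, (hp.exists_mul (c • f)).choose_spec z hz,
          (hp.exists_mul f).choose_spec z hz, Submodule.coe_smul, Hardy2.eval_smul _ _ hz]
        ring }

theorem toeplitz_eval {g a b : ℂ → ℂ} (hp : IsCanonicalPair g a b) (f : (toeplitz hp).domain)
    {z : ℂ} (hz : ‖z‖ < 1) :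
    Hardy2.eval (toeplitz hp f) z = g z * Hardy2.eval f z :=
  (hp.exists_mul f).choose_spec z hz

/-- `B` is (on the disk) a finite Blaschke product with `n` factors. -/
def IsFiniteBlaschke (n : ℕ) (B : ℂ → ℂ) : Prop :=
  ∃ (c : ℂ) (α : Fin n → ℂ), ‖c‖ = 1 ∧ (∀ j, ‖α j‖ < 1) ∧
    ∀ z ∈ Metric.ball (0 : ℂ) 1, B z = c * ∏ j, (z - α j) / (1 - (starRingEnd ℂ) (α j) * z)

/-- The `n`-fold direct sum of an unbounded operator `T` in `H`, acting coordinatewise in the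
Hilbert space direct sum of `n` copies of `H`, on the `n`-tuples of elements of the domain. -/
noncomputable def directSumOp {H : Type*} [NormedAddCommGroup H] [InnerProductSpace ℂ H] (n : ℕ)
    (T : H →ₗ.[ℂ] H) :
    PiLp 2 (fun _ : Fin n => H) →ₗ.[ℂ] PiLp 2 (fun _ : Fin n => H) where
  domain :=
    { carrier := {f | ∀ j, f j ∈ T.domain}
      zero_mem' := fun j => T.domain.zero_mem
      add_mem' := fun hf hg j => T.domain.add_mem (hf j) (hg j)
      smul_mem' := fun c _ hf j => T.domain.smul_mem c (hf j) }
  toFun :=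
    { toFun := fun f => WithLp.toLp 2 fun j => T ⟨f.1 j, f.2 j⟩
      map_add' := fun f g => by
        ext1 j
        exact T.map_add ⟨f.1 j, f.2 j⟩ ⟨g.1 j, g.2 j⟩
      map_smul' := fun c f => by
        ext1 j
        exact T.map_smul c ⟨f.1 j, f.2 j⟩ }

/-- The unitary `U` carries the unbounded operator `S` to the unbounded operator `T`: it maps the
domain of `S` onto the domain of `T`, and `T U = U S` on the domain of `S`. -/
def CarriesTo {H K : Type*} [NormedAddCommGroup H] [InnerProductSpace ℂ H]
    [NormedAddCommGroup K] [InnerProductSpace ℂ K] (S : H →ₗ.[ℂ] H)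
    (T : K →ₗ.[ℂ] K) (U : H ≃ₗᵢ[ℂ] K) : Prop :=
  (∀ x, x ∈ S.domain ↔ U x ∈ T.domain) ∧
    ∀ (x : S.domain) (y : T.domain), (y : K) = U x → T y = U (S x)

/-- Unitary equivalence of unbounded operators. -/
def UnitarilyEquivalent {H K : Type*} [NormedAddCommGroup H] [InnerProductSpace ℂ H]
    [NormedAddCommGroup K] [InnerProductSpace ℂ K]
    (S : H →ₗ.[ℂ] H) (T : K →ₗ.[ℂ] K) : Prop :=
  ∃ U : H ≃ₗᵢ[ℂ] K, CarriesTo S T U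

/-! Multiplication by `B` is an isometry `V` of `H²`, and it is pure: an element of every `B^k H²`
satisfies `|x(z)| ≤ |B(z)|^k ‖x‖ / (1 - |z|)` with `|B(z)| < 1`, so it vanishes. By the Wold
decomposition, the vectors `B^k w_j` form an orthonormal basis of `H²` whenever the `w_j` form one
of `(B H²)ᗮ`. The unitary `U` sends the monomial `z^k` in the `j`-th coordinate to `w_j B^k`, and
evaluation at points of the disk turns this into the formula of the theorem
(`Hardy2.exists_unitary`). The dimension of `(B H²)ᗮ` is additive over products, and for one
Blaschke factor it is `1`, the space being spanned by a Szegő kernel.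

The formula shows that `U` turns coordinatewise multiplication by `φ` into multiplication by `φ ∘
B`. Hence `U` maps the sum of copies of `a H²` onto `(a ∘ B) H²` and intertwines `g` with `g ∘ B`
(`carriesTo_toeplitz_comp`). It remains to know that `(a ∘ B) H²` is the domain of `T_{g ∘ B}`, that
is, that `(a ∘ B, b ∘ B)` is the canonical pair of `g ∘ B` up to a unimodular factor.

This rests on one fact: the boundary map `β` of `B` pushes the harmonic measure at `z` forward to
the harmonic measure at `B z`, because both measures have moments `B(z)^j`. So composition with `B`
turns the Poisson integral of `F` into that of `F ∘ β`. With Fatou's theorem, boundary identities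
pass from `(a, b)` to `(a ∘ B, b ∘ B)`, and outer functions stay outer. A canonical pair exists
because `|u|² + |v|²` has an integrable logarithm, which supplies the outer normalizing factor; its
denominator is unique up to a unimodular constant because its boundary modulus is determined by `g`.
-/

section LinearIsometry

/-! ### Wandering spaces and the Wold decomposition of an isometry -/

variable {H : Type*} [NormedAddCommGroup H] [InnerProductSpace ℂ H]

/-- A vector is orthogonal to the orthogonal complement of the range of an isometry iff it lies in
the range. -/
theorem LinearIsometry.range_orthogonal_orthogonal [CompleteSpace H] (V : H →ₗᵢ[ℂ] H) :
    (LinearMap.range V.toLinearMap)ᗮᗮ = LinearMap.range V.toLinearMap := by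
  have hc : IsClosed (LinearMap.range V.toLinearMap : Set H) := by
    have := V.isometry.isClosedEmbedding.isClosed_range
    simpa [LinearMap.coe_range] using this
  have : CompleteSpace (LinearMap.range V.toLinearMap) := hc.completeSpace_coe
  exact Submodule.orthogonal_orthogonal _

/-- The wandering space of a product of isometries is the direct sum of those of the factors. -/
theorem LinearIsometry.exists_orthogonal_range_comp_equiv [CompleteSpace H] (V W : H →ₗᵢ[ℂ] H) :
    Nonempty ((((LinearMap.range V.toLinearMap)ᗮ : Submodule ℂ H) ×
      ((LinearMap.range W.toLinearMap)ᗮ : Submodule ℂ H)) ≃ₗ[ℂ]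
      ((LinearMap.range (V.comp W).toLinearMap)ᗮ : Submodule ℂ H)) := by
  have hc : IsClosed (LinearMap.range V.toLinearMap : Set H) := by
    have := V.isometry.isClosedEmbedding.isClosed_range
    simpa [LinearMap.coe_range] using this
  have : CompleteSpace (LinearMap.range V.toLinearMap) := hc.completeSpace_coe
  let F : (((LinearMap.range V.toLinearMap)ᗮ : Submodule ℂ H) ×
      ((LinearMap.range W.toLinearMap)ᗮ : Submodule ℂ H)) →ₗ[ℂ] H :=
    LinearMap.coprod (Submodule.subtype _) (V.toLinearMap ∘ₗ Submodule.subtype _)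
  have hF : ∀ x, F x ∈ (LinearMap.range (V.comp W).toLinearMap)ᗮ := by
    rintro ⟨⟨x, hx⟩, ⟨y, hy⟩⟩
    rw [Submodule.mem_orthogonal] at hx hy ⊢
    rintro _ ⟨u, rfl⟩
    have h1 := hx (V (W u)) ⟨W u, rfl⟩
    have h2 := hy (W u) ⟨u, rfl⟩
    change inner ℂ (V (W u)) (x + V y) = 0
    rw [inner_add_right, h1, V.inner_map_map, h2, add_zero]
  refine ⟨LinearEquiv.ofBijective (F.codRestrict _ hF) ⟨?_, ?_⟩⟩
  · rw [← LinearMap.ker_eq_bot, LinearMap.ker_eq_bot']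
    rintro ⟨⟨x, hx⟩, ⟨y, hy⟩⟩ h
    have h0 : x + V y = 0 := congrArg Subtype.val h
    have hxV : inner ℂ (V y) x = 0 := (Submodule.mem_orthogonal _ _).1 hx _ ⟨y, rfl⟩
    have hyz : V y = 0 := by
      have : inner ℂ (V y) (x + V y) = 0 := by rw [h0, inner_zero_right]
      rw [inner_add_right, hxV, zero_add] at this
      exact inner_self_eq_zero.1 this
    have hxz : x = 0 := by simpa [hyz] using h0
    have hyz' : y = 0 := V.injective (by rw [hyz, map_zero])
    simp [hxz, hyz']
  · rintro ⟨v, hv⟩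
    obtain ⟨p, ⟨y, rfl⟩, x, hx, hvx⟩ :=
      Submodule.exists_add_mem_mem_orthogonal (K := LinearMap.range V.toLinearMap) v
    have hy : y ∈ (LinearMap.range W.toLinearMap)ᗮ := by
      rw [Submodule.mem_orthogonal] at hv hx ⊢
      rintro _ ⟨u, rfl⟩
      have h1 := hv (V (W u)) ⟨u, rfl⟩
      have h2 := hx (V (W u)) ⟨W u, rfl⟩
      rw [hvx, inner_add_right, h2, add_zero] at h1
      rw [← V.inner_map_map]
      exact h1
    refine ⟨(⟨x, hx⟩, ⟨y, hy⟩), Subtype.ext ?_⟩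
    change x + V y = v
    rw [hvx, add_comm]; rfl

variable {ι : Type*} [Fintype ι] (V : H →ₗᵢ[ℂ] H)
  (w : OrthonormalBasis ι ℂ ((LinearMap.range V.toLinearMap)ᗮ : Submodule ℂ H))

/-- For different exponents, cancel the smaller power of the isometry: one vector then lies in the
range of `V` and the other in its orthogonal complement. For equal exponents only the orthonormality
of `w` is left. -/
theorem LinearIsometry.orthonormal_pow_apply :
    Orthonormal ℂ fun p : ι × ℕ => (V ^ p.2) (w p.1 : H) := by
  classical
  have hlt : ∀ (i j : ι) (k l : ℕ), inner ℂ ((V ^ (k + (l + 1))) (w i : H)) ((V ^ k) (w j : H)) = 0 := by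
    intro i j k l
    rw [pow_add, LinearIsometry.coe_mul, Function.comp_apply, LinearIsometry.inner_map_map, pow_succ',
      LinearIsometry.coe_mul, Function.comp_apply]
    exact (Submodule.mem_orthogonal _ _).1 (w j).2 _ ⟨_, rfl⟩
  rw [orthonormal_iff_ite]
  rintro ⟨i, k⟩ ⟨j, l⟩
  rcases lt_trichotomy k l with h | rfl | h
  · obtain ⟨d, rfl⟩ := Nat.exists_eq_add_of_lt h
    rw [if_neg (by simp; omega), ← inner_conj_symm, add_assoc]
    simp only
    rw [hlt, map_zero]
  · simp only [LinearIsometry.inner_map_map, Prod.mk.injEq, and_true]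
    have := orthonormal_iff_ite.1 w.orthonormal i j
    simpa using this
  · obtain ⟨d, rfl⟩ := Nat.exists_eq_add_of_lt h
    rw [if_neg (by simp; omega), add_assoc]
    exact hlt _ _ _ _

/-- The Wold decomposition of a pure isometry. -/
theorem LinearIsometry.span_pow_apply_orthogonal [CompleteSpace H]
    (hV : ∀ x, (∀ k, ∃ y, x = (V ^ k) y) → x = 0) :
    (Submodule.span ℂ (Set.range fun p : ι × ℕ => (V ^ p.2) (w p.1 : H)))ᗮ = ⊥ := by
  rw [Submodule.eq_bot_iff]
  intro x hx
  have hx' : ∀ i k, inner ℂ ((V ^ k) (w i : H)) x = 0 := fun i k =>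
    (Submodule.mem_orthogonal _ _).1 hx _ (Submodule.subset_span ⟨(i, k), rfl⟩)
  refine hV x fun k => ?_
  induction k with
  | zero => exact ⟨x, by simp⟩
  | succ k ih =>
    obtain ⟨y, rfl⟩ := ih
    -- Here the vector is `V^k y`. Its orthogonality to every `V^k w_i` says that `y` is orthogonal
    -- to the whole wandering space, so `y` lies in the range of `V` and one more power can be
    -- extracted.
    have hy : y ∈ (LinearMap.range V.toLinearMap)ᗮᗮ := by
      rw [Submodule.mem_orthogonal]
      intro u hu
      have hsum := w.sum_repr ⟨u, hu⟩
      have : u = ∑ i, w.repr ⟨u, hu⟩ i • (w i : H) := by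
        conv_lhs => rw [← Subtype.coe_mk u hu, ← hsum]
        simp
      rw [this, sum_inner]
      refine Finset.sum_eq_zero fun i _ => ?_
      have h1 := hx' i k
      rw [LinearIsometry.inner_map_map] at h1
      rw [inner_smul_left, h1, mul_zero]
    rw [V.range_orthogonal_orthogonal] at hy
    obtain ⟨z, rfl⟩ := hy
    exact ⟨z, by rw [pow_succ, LinearIsometry.coe_mul, Function.comp_apply]; rfl⟩

end LinearIsometry

/-! ### `H²` as the space of square-summable Taylor coefficients -/

namespace Hardy2

theorem ext_coeff {f g : Hardy2} (h : ∀ k, coeff k f = coeff k g) : f = g := by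
  refine ext_eval fun z hz => (hasSum_eval f hz).unique ?_
  simpa only [h] using hasSum_eval g hz

theorem hasSum_norm_sq (f : Hardy2) : HasSum (fun k : ℕ => ‖coeff k f‖ ^ 2) (‖f‖ ^ 2) := by
  have h := hasSum_sq_fourierCoeff (f : Lp ℂ 2 (haarAddCircle : Measure UnitAddCircle))
  have h2 : ∫ t, ‖(f : Lp ℂ 2 (haarAddCircle : Measure UnitAddCircle)) t‖ ^ 2 ∂haarAddCircle =
      ‖f‖ ^ 2 := by
    have h3 := L2.inner_def (𝕜 := ℂ) (f : Lp ℂ 2 (haarAddCircle : Measure UnitAddCircle)) f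
    rw [inner_self_eq_norm_sq_to_K] at h3
    simp only [inner_self_eq_norm_sq_to_K] at h3
    have h4 : ∫ t, (((‖(f : Lp ℂ 2 (haarAddCircle : Measure UnitAddCircle)) t‖ ^ 2 : ℝ)) : ℂ)
        ∂haarAddCircle = ((‖f‖ ^ 2 : ℝ) : ℂ) := by
      rw [Submodule.coe_norm]
      push_cast
      exact h3.symm
    rw [integral_complex_ofReal] at h4
    exact_mod_cast h4
  rw [h2] at h
  rw [← Function.Injective.hasSum_iff (Nat.cast_injective (R := ℤ))] at h
  · exact h
  · intro k hk
    have : k < 0 := by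
      by_contra h0
      exact hk ⟨k.toNat, by simp [not_lt.1 h0]⟩
    simp [f.2 k this]

theorem memℓp_coeff (f : Hardy2) : Memℓp (fun k => coeff k f) 2 :=
  memℓp_gen (by simpa using summable_sq f)

/-- The Taylor coefficients as a linear map into `ℓ²`. -/
noncomputable def taylor : Hardy2 →ₗ[ℂ] lp (fun _ : ℕ => ℂ) 2 where
  toFun f := ⟨fun k => coeff k f, memℓp_coeff f⟩
  map_add' f g := by
    apply lp.ext; funext k; exact (coeff k).map_add f g
  map_smul' c f := by
    apply lp.ext; funext k; exact (coeff k).map_smul c f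

theorem taylor_apply (f : Hardy2) (k : ℕ) : taylor f k = coeff k f := rfl

theorem taylor_bijective : Function.Bijective taylor := by
  refine ⟨fun f g h => ext_coeff fun k => ?_, fun c => ?_⟩
  · rw [← taylor_apply, h, taylor_apply]
  · obtain ⟨f, hf⟩ := exists_of_summable_sq (fun k => c k) (by
      have := (lp.memℓp c).summable (by norm_num)
      simpa using this)
    exact ⟨f, lp.ext (funext hf)⟩

theorem norm_taylor (f : Hardy2) : ‖taylor f‖ = ‖f‖ := by
  have h1 := lp.norm_rpow_eq_tsum (p := 2) (by norm_num) (taylor f)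
  have h2 := (hasSum_norm_sq f).tsum_eq
  simp only [ENNReal.toReal_ofNat, Real.rpow_ofNat, taylor_apply] at h1
  rw [h2] at h1
  exact (pow_left_inj₀ (norm_nonneg _) (norm_nonneg _) two_ne_zero).1 h1

/-- `H²` as the space of square-summable Taylor coefficients. -/
noncomputable def taylorEquiv : Hardy2 ≃ₗᵢ[ℂ] lp (fun _ : ℕ => ℂ) 2 where
  toLinearEquiv := LinearEquiv.ofBijective taylor taylor_bijective
  norm_map' := norm_taylor

instance : CompleteSpace Hardy2 :=
  (completeSpace_congr (e := taylorEquiv.toEquiv) taylorEquiv.isometry.isUniformEmbedding).2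
    inferInstance

/-- The monomials as a Hilbert basis of `H²`. -/
noncomputable def monomialBasis : HilbertBasis ℕ ℂ Hardy2 := HilbertBasis.ofRepr taylorEquiv

theorem inner_monomialBasis (k : ℕ) (f : Hardy2) : inner ℂ (monomialBasis k) f = coeff k f := by
  rw [← HilbertBasis.repr_apply_apply]; rfl

theorem norm_coeff_le (k : ℕ) (f : Hardy2) : ‖coeff k f‖ ≤ ‖f‖ := by
  rw [← sq_le_sq₀ (norm_nonneg _) (norm_nonneg _)]
  exact le_hasSum (hasSum_norm_sq f) k fun _ _ => by positivity

theorem norm_eval_le (f : Hardy2) {z : ℂ} (hz : ‖z‖ < 1) : ‖eval f z‖ ≤ ‖f‖ * (1 - ‖z‖)⁻¹ := by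
  rw [← (hasSum_eval f hz).tsum_eq]
  refine tsum_of_norm_bounded ((hasSum_geometric_of_lt_one (norm_nonneg z) hz).mul_left ‖f‖)
    fun k => ?_
  rw [norm_mul, norm_pow]
  gcongr
  exact norm_coeff_le k f

/-- Evaluation at a point of the disk as a continuous linear functional. -/
noncomputable def evalCLM {z : ℂ} (hz : ‖z‖ < 1) : Hardy2 →L[ℂ] ℂ :=
  LinearMap.mkContinuous
    { toFun := fun f => eval f z
      map_add' := fun f g => eval_add f g hz
      map_smul' := fun c f => eval_smul c f hz } (1 - ‖z‖)⁻¹ fun f => by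
    rw [mul_comm]; exact norm_eval_le f hz

theorem evalCLM_apply {z : ℂ} (hz : ‖z‖ < 1) (f : Hardy2) : evalCLM hz f = eval f z := rfl

end Hardy2

/-! ### Bounded analytic functions and Blaschke factors -/

theorem IsHInfty.mul {φ ψ : ℂ → ℂ} (hφ : IsHInfty φ) (hψ : IsHInfty ψ) :
    IsHInfty fun z => φ z * ψ z := by
  obtain ⟨hφ, M, hM⟩ := hφ
  obtain ⟨hψ, N, hN⟩ := hψ
  refine ⟨hφ.mul hψ, M * N, fun z hz => ?_⟩
  rw [norm_mul]
  exact mul_le_mul (hM z hz) (hN z hz) (norm_nonneg _) ((norm_nonneg _).trans (hM z hz))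

theorem IsHInfty.congr {φ ψ : ℂ → ℂ} (hφ : IsHInfty φ)
    (h : ∀ z ∈ Metric.ball (0 : ℂ) 1, ψ z = φ z) : IsHInfty ψ := by
  obtain ⟨hφ, M, hM⟩ := hφ
  exact ⟨hφ.congr h, M, fun z hz => by rw [h z hz]; exact hM z hz⟩

theorem IsHInfty.const (c : ℂ) : IsHInfty fun _ => c :=
  ⟨differentiableOn_const c, ‖c‖, fun _ _ => le_rfl⟩

theorem IsHInfty.id : IsHInfty fun z => z :=
  ⟨differentiableOn_id, 1, fun z hz => (by simpa using hz : ‖z‖ < 1).le⟩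

theorem IsHInfty.comp {φ B : ℂ → ℂ} (hφ : IsHInfty φ) (hB : IsHInfty B)
    (hB1 : ∀ z ∈ Metric.ball (0 : ℂ) 1, ‖B z‖ < 1) : IsHInfty (φ ∘ B) := by
  obtain ⟨hφ, M, hM⟩ := hφ
  have hm : Set.MapsTo B (Metric.ball 0 1) (Metric.ball 0 1) := fun z hz => by
    simpa using hB1 z hz
  exact ⟨hφ.comp hB.1 hm, M, fun z hz => hM _ (hm hz)⟩

/-- The Blaschke factor vanishing at `α`. -/
noncomputable def blaschkeFactor (α z : ℂ) : ℂ := (z - α) / (1 - (starRingEnd ℂ) α * z)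

/-- The last term is positive for `|α|, |z| < 1` and vanishes for `|z| = 1`. Both modulus statements
on Blaschke factors are read off from this identity. -/
theorem norm_sq_one_sub_conj_mul (α z : ℂ) :
    ‖1 - (starRingEnd ℂ) α * z‖ ^ 2 = ‖z - α‖ ^ 2 + (1 - ‖α‖ ^ 2) * (1 - ‖z‖ ^ 2) := by
  simp only [← Complex.normSq_eq_norm_sq, Complex.normSq_apply]
  simp
  ring

theorem one_sub_norm_le_norm_one_sub_conj_mul (α : ℂ) {z : ℂ} (hz : ‖z‖ ≤ 1) :
    1 - ‖α‖ ≤ ‖1 - (starRingEnd ℂ) α * z‖ := by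
  have h := norm_sub_norm_le (1 : ℂ) ((starRingEnd ℂ) α * z)
  rw [norm_one, norm_mul, Complex.norm_conj] at h
  nlinarith [norm_nonneg α]

theorem one_sub_conj_mul_ne_zero {α z : ℂ} (hα : ‖α‖ < 1) (hz : ‖z‖ ≤ 1) :
    1 - (starRingEnd ℂ) α * z ≠ 0 := by
  rw [← norm_pos_iff]
  have := one_sub_norm_le_norm_one_sub_conj_mul α hz
  linarith

theorem norm_blaschkeFactor_lt {α z : ℂ} (hα : ‖α‖ < 1) (hz : ‖z‖ < 1) :
    ‖blaschkeFactor α z‖ < 1 := by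
  have h0 := norm_pos_iff.2 (one_sub_conj_mul_ne_zero hα hz.le)
  rw [blaschkeFactor, norm_div, div_lt_one h0, ← sq_lt_sq₀ (norm_nonneg _) (norm_nonneg _),
    norm_sq_one_sub_conj_mul]
  have h1 : 0 < 1 - ‖α‖ ^ 2 := by nlinarith [norm_nonneg α]
  have h2 : 0 < 1 - ‖z‖ ^ 2 := by nlinarith [norm_nonneg z]
  nlinarith [mul_pos h1 h2]

theorem norm_blaschkeFactor_eq {α z : ℂ} (hα : ‖α‖ < 1) (hz : ‖z‖ = 1) :
    ‖blaschkeFactor α z‖ = 1 := by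
  have h0 := norm_pos_iff.2 (one_sub_conj_mul_ne_zero hα hz.le)
  rw [blaschkeFactor, norm_div, div_eq_one_iff_eq h0.ne',
    ← sq_eq_sq₀ (norm_nonneg _) (norm_nonneg _), norm_sq_one_sub_conj_mul, hz]
  ring

theorem isHInfty_inv_one_sub_conj_mul {α : ℂ} (hα : ‖α‖ < 1) :
    IsHInfty fun z => (1 - (starRingEnd ℂ) α * z)⁻¹ := by
  refine ⟨?_, (1 - ‖α‖)⁻¹, fun z hz => ?_⟩
  · refine DifferentiableOn.inv (by fun_prop) fun z hz => ?_
    exact one_sub_conj_mul_ne_zero hα (by simpa using hz : ‖z‖ < 1).le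
  · rw [norm_inv]
    refine inv_anti₀ (by linarith) ?_
    exact one_sub_norm_le_norm_one_sub_conj_mul α (by simpa using hz : ‖z‖ < 1).le

theorem isHInfty_blaschkeFactor {α : ℂ} (hα : ‖α‖ < 1) : IsHInfty (blaschkeFactor α) := by
  refine ⟨fun z hz => ?_, 1, fun z hz => (norm_blaschkeFactor_lt hα (by simpa using hz)).le⟩
  have h0 := one_sub_conj_mul_ne_zero hα (by simpa using hz : ‖z‖ < 1).le
  have h : DifferentiableAt ℂ (fun z => (z - α) / (1 - (starRingEnd ℂ) α * z)) z :=
    DifferentiableAt.div (by fun_prop) (by fun_prop) h0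
  exact h.differentiableWithinAt

/-! ### Isometric multipliers and the codimension of their ranges -/

namespace Hardy2

theorem eval_sub (f g : Hardy2) {z : ℂ} (hz : ‖z‖ < 1) :
    eval (f - g) z = eval f z - eval g z := (evalCLM hz).map_sub f g

theorem mulRange_congr {φ ψ : ℂ → ℂ} (h : ∀ z ∈ Metric.ball (0 : ℂ) 1, ψ z = φ z) :
    mulRange ψ = mulRange φ := by
  have h' : ∀ z : ℂ, ‖z‖ < 1 → ψ z = φ z := fun z hz => h z (by simpa using hz)
  ext f
  refine exists_congr fun k => forall₂_congr fun z hz => ?_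
  rw [h' z hz]

/-- `φ` is a bounded analytic function such that multiplication by `φ` is isometric on `H²`. -/
def IsIsometricMultiplier (φ : ℂ → ℂ) : Prop :=
  IsHInfty φ ∧ ∀ f k : Hardy2, (∀ z : ℂ, ‖z‖ < 1 → eval k z = φ z * eval f z) → ‖k‖ = ‖f‖

/-- Multiplication by an isometric multiplier. -/
noncomputable def IsIsometricMultiplier.toIsometry {φ : ℂ → ℂ} (h : IsIsometricMultiplier φ) :
    Hardy2 →ₗᵢ[ℂ] Hardy2 where
  toFun f := (exists_mul φ h.1.1 h.1.2 f).choose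
  map_add' f g := ext_eval fun z hz => by
    rw [eval_add _ _ hz, (exists_mul φ h.1.1 h.1.2 (f + g)).choose_spec z hz,
      (exists_mul φ h.1.1 h.1.2 f).choose_spec z hz, (exists_mul φ h.1.1 h.1.2 g).choose_spec z hz,
      eval_add _ _ hz, mul_add]
  map_smul' c f := ext_eval fun z hz => by
    rw [RingHom.id_apply, eval_smul _ _ hz, (exists_mul φ h.1.1 h.1.2 (c • f)).choose_spec z hz,
      (exists_mul φ h.1.1 h.1.2 f).choose_spec z hz, eval_smul _ _ hz, mul_left_comm]
  norm_map' f := h.2 _ _ (exists_mul φ h.1.1 h.1.2 f).choose_spec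

theorem IsIsometricMultiplier.eval_toIsometry {φ : ℂ → ℂ} (h : IsIsometricMultiplier φ)
    (f : Hardy2) {z : ℂ} (hz : ‖z‖ < 1) : eval (h.toIsometry f) z = φ z * eval f z :=
  (exists_mul φ h.1.1 h.1.2 f).choose_spec z hz

theorem IsIsometricMultiplier.eval_toIsometry_pow {φ : ℂ → ℂ} (h : IsIsometricMultiplier φ)
    (k : ℕ) (f : Hardy2) {z : ℂ} (hz : ‖z‖ < 1) :
    eval ((h.toIsometry ^ k) f) z = φ z ^ k * eval f z := by
  induction k with
  | zero => simp
  | succ k ih =>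
    rw [pow_succ', LinearIsometry.coe_mul, Function.comp_apply, h.eval_toIsometry _ hz, ih]
    ring

theorem IsIsometricMultiplier.range_toIsometry {φ : ℂ → ℂ} (h : IsIsometricMultiplier φ) :
    LinearMap.range h.toIsometry.toLinearMap = mulRange φ := by
  ext f
  constructor
  · rintro ⟨k, rfl⟩
    exact ⟨k, fun z hz => h.eval_toIsometry k hz⟩
  · rintro ⟨k, hk⟩
    exact ⟨k, ext_eval fun z hz => (h.eval_toIsometry k hz).trans (hk z hz).symm⟩

theorem IsIsometricMultiplier.congr {φ ψ : ℂ → ℂ} (h : IsIsometricMultiplier φ)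
    (he : ∀ z ∈ Metric.ball (0 : ℂ) 1, ψ z = φ z) : IsIsometricMultiplier ψ :=
  ⟨h.1.congr he, fun f k hk => h.2 f k fun z hz => by rw [hk z hz, he z (by simpa using hz)]⟩

theorem IsIsometricMultiplier.mul {φ ψ : ℂ → ℂ} (h : IsIsometricMultiplier φ)
    (h' : IsIsometricMultiplier ψ) : IsIsometricMultiplier fun z => φ z * ψ z := by
  refine ⟨h.1.mul h'.1, fun f k hk => ?_⟩
  have : k = h.toIsometry (h'.toIsometry f) := ext_eval fun z hz => by
    rw [hk z hz, h.eval_toIsometry _ hz, h'.eval_toIsometry _ hz, mul_assoc]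
  rw [this, LinearIsometry.norm_map, LinearIsometry.norm_map]

theorem IsIsometricMultiplier.const {c : ℂ} (hc : ‖c‖ = 1) :
    IsIsometricMultiplier fun _ => c := by
  refine ⟨IsHInfty.const c, fun f k hk => ?_⟩
  have : k = c • f := ext_eval fun z hz => by rw [hk z hz, eval_smul _ _ hz]
  rw [this, norm_smul, hc, one_mul]

theorem eval_eq_of_coeff {k : Hardy2} {z a : ℂ} (hz : ‖z‖ < 1)
    (h : HasSum (fun j : ℕ => coeff j k * z ^ j) a) : eval k z = a :=
  (hasSum_eval k hz).unique h

/-- Multiplication by `z` shifts the Taylor coefficients by one place and inserts a zero, which does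
not change their `ℓ²` norm. -/
theorem IsIsometricMultiplier.id : IsIsometricMultiplier fun z => z := by
  refine ⟨IsHInfty.id, fun f k hk => ?_⟩
  have hf := hasSum_norm_sq f
  obtain ⟨s, hs⟩ := exists_of_summable_sq (fun j => Nat.casesOn j 0 fun i => coeff i f) (by
    rw [← summable_nat_add_iff 1]
    exact hf.summable)
  have h1 : s = k := ext_eval fun z hz => by
    rw [hk z hz]
    apply eval_eq_of_coeff hz
    rw [← hasSum_nat_add_iff' 1]
    simpa [hs, pow_succ', mul_left_comm] using (hasSum_eval f hz).mul_left z
  rw [← sq_eq_sq₀ (norm_nonneg _) (norm_nonneg _), ← h1]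
  refine (hasSum_norm_sq s).unique ?_
  rw [← hasSum_nat_add_iff' 1]
  simpa [hs] using hf

theorem inner_smul_right_eq (f g : Hardy2) (c : ℂ) : inner ℂ f (c • g) = c * inner ℂ f g :=
  inner_smul_right f g c

theorem inner_smul_left_eq (f g : Hardy2) (c : ℂ) :
    inner ℂ (c • f) g = (starRingEnd ℂ) c * inner ℂ f g :=
  inner_smul_left f g c

/-- With `S` the shift and `q = f / (1 - ᾱ z)`, one has `f = q - ᾱ S q` and `b_α f = S q - α q`. As
`S` is isometric, both squared norms equal `(1 + |α|²) ‖q‖²` minus the same cross term, so no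
boundary values are needed. -/
theorem isIsometricMultiplier_blaschkeFactor {α : ℂ} (hα : ‖α‖ < 1) :
    IsIsometricMultiplier (blaschkeFactor α) := by
  refine ⟨isHInfty_blaschkeFactor hα, fun f k hk => ?_⟩
  obtain ⟨q, hq⟩ := exists_mul _ (isHInfty_inv_one_sub_conj_mul hα).1
    (isHInfty_inv_one_sub_conj_mul hα).2 f
  let S := IsIsometricMultiplier.id.toIsometry
  have hS : ∀ (x : Hardy2) (z : ℂ), ‖z‖ < 1 → eval (S x) z = z * eval x z := fun x z hz =>
    IsIsometricMultiplier.id.eval_toIsometry x hz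
  have hf : f = q - (starRingEnd ℂ) α • S q := ext_eval fun z hz => by
    have := one_sub_conj_mul_ne_zero hα hz.le
    rw [eval_sub _ _ hz, eval_smul _ _ hz, hS _ _ hz, hq z hz]
    field_simp
  have hk' : k = S q - α • q := ext_eval fun z hz => by
    have := one_sub_conj_mul_ne_zero hα hz.le
    rw [eval_sub _ _ hz, eval_smul _ _ hz, hS _ _ hz, hk z hz, hq z hz, blaschkeFactor]
    field_simp
  rw [← sq_eq_sq₀ (norm_nonneg _) (norm_nonneg _), hf, hk', @norm_sub_sq ℂ, @norm_sub_sq ℂ,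
    inner_smul_right_eq, inner_smul_right_eq, norm_smul, norm_smul, Complex.norm_conj, S.norm_map,
    ← inner_conj_symm q, ← map_mul]
  simp only [RCLike.conj_re]

theorem inner_eq_tsum (f g : Hardy2) :
    HasSum (fun k => (starRingEnd ℂ) (coeff k f) * coeff k g) (inner ℂ f g) := by
  have := monomialBasis.hasSum_inner_mul_inner f g
  simpa only [inner_monomialBasis, ← inner_conj_symm f] using this

theorem coeff_monomialBasis (j k : ℕ) : coeff j (monomialBasis k) = if j = k then 1 else 0 := by
  rw [← inner_monomialBasis]
  exact orthonormal_iff_ite.1 monomialBasis.orthonormal j k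

theorem eval_monomialBasis (k : ℕ) {z : ℂ} (hz : ‖z‖ < 1) : eval (monomialBasis k) z = z ^ k := by
  apply eval_eq_of_coeff hz
  have := hasSum_single (f := fun j => coeff j (monomialBasis k) * z ^ j) k fun j hj => by
    simp [coeff_monomialBasis, hj]
  simpa [coeff_monomialBasis] using this

/-- `φ` is an isometric multiplier whose range has codimension `n`. -/
structure IsInnerOfDegree (n : ℕ) (φ : ℂ → ℂ) : Prop where
  isometric : IsIsometricMultiplier φ
  finiteDimensional : FiniteDimensional ℂ (mulRange φ)ᗮ
  finrank : Module.finrank ℂ (mulRange φ)ᗮ = n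

theorem IsInnerOfDegree.congr {n : ℕ} {φ ψ : ℂ → ℂ} (h : IsInnerOfDegree n φ)
    (he : ∀ z ∈ Metric.ball (0 : ℂ) 1, ψ z = φ z) : IsInnerOfDegree n ψ := by
  refine ⟨h.1.congr he, ?_, ?_⟩
  · rw [mulRange_congr he]; exact h.2
  · rw [mulRange_congr he]; exact h.3

/-- Multiplication by `φ ψ` is the composite of the two isometries, so its wandering space is
linearly isomorphic to the product of theirs and the dimensions add. -/
theorem IsInnerOfDegree.mul {m n : ℕ} {φ ψ : ℂ → ℂ} (h : IsInnerOfDegree m φ)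
    (h' : IsInnerOfDegree n ψ) : IsInnerOfDegree (m + n) fun z => φ z * ψ z := by
  have hm := h.1.mul h'.1
  have he : LinearMap.range (h.1.toIsometry.comp h'.1.toIsometry).toLinearMap =
      mulRange fun z => φ z * ψ z := by
    rw [← hm.range_toIsometry]
    congr 2
    ext1 f
    refine ext_eval fun z hz => ?_
    rw [hm.eval_toIsometry _ hz, LinearIsometry.coe_comp, Function.comp_apply, h.1.eval_toIsometry _ hz,
      h'.1.eval_toIsometry _ hz, mul_assoc]
  obtain ⟨e⟩ := h.1.toIsometry.exists_orthogonal_range_comp_equiv h'.1.toIsometry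
  rw [he, h.1.range_toIsometry, h'.1.range_toIsometry] at e
  have := h.2
  have := h'.2
  exact ⟨hm, Module.Finite.equiv e, by rw [← e.finrank_eq, Module.finrank_prod, h.3, h'.3]⟩

theorem IsInnerOfDegree.const {c : ℂ} (hc : ‖c‖ = 1) : IsInnerOfDegree 0 fun _ => c := by
  have hc0 : c ≠ 0 := fun h => by simp [h] at hc
  have h : mulRange (fun _ => c) = ⊤ := by
    rw [eq_top_iff]
    intro f _
    exact ⟨c⁻¹ • f, fun z hz => by rw [eval_smul _ _ hz]; field_simp⟩
  refine ⟨.const hc, ?_, ?_⟩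
  · rw [h, Submodule.top_orthogonal_eq_bot]; infer_instance
  · rw [h, Submodule.top_orthogonal_eq_bot, finrank_bot]

theorem isInnerOfDegree_blaschkeFactor {α : ℂ} (hα : ‖α‖ < 1) :
    IsInnerOfDegree 1 (blaschkeFactor α) := by
  have hα' : ‖(starRingEnd ℂ) α‖ < 1 := by rwa [Complex.norm_conj]
  -- `κ` is the Szegő kernel at `α`: the inner product with it is evaluation at `α`, where every
  -- multiple of the Blaschke factor vanishes.
  obtain ⟨κ, hκ⟩ := exists_of_summable_sq (fun k => (starRingEnd ℂ) α ^ k) (by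
    simp_rw [norm_pow, ← pow_mul, mul_comm _ 2, pow_mul]
    exact summable_geometric_of_lt_one (by positivity) (pow_lt_one₀ (norm_nonneg _) hα' two_ne_zero))
  have hmem : κ ∈ (mulRange (blaschkeFactor α))ᗮ := by
    rw [Submodule.mem_orthogonal']
    rintro f ⟨h, hf⟩
    have h1 : inner ℂ κ f = eval f α := by
      refine (inner_eq_tsum κ f).unique ?_
      simpa [hκ, mul_comm] using hasSum_eval f hα
    rw [h1, hf α hα, blaschkeFactor]
    simp
  have hne : (⟨κ, hmem⟩ : (mulRange (blaschkeFactor α))ᗮ) ≠ 0 := fun h => by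
    have h1 : κ = 0 := congrArg Subtype.val h
    have h2 := hκ 0
    rw [h1, map_zero] at h2
    simp at h2
  -- Since `z^(k+1) - α z^k` is the Blaschke factor times `z^k - ᾱ z^(k+1)`, orthogonality to it is
  -- a first-order recursion. Its solutions are the multiples of `κ`.
  have hrec : ∀ x ∈ (mulRange (blaschkeFactor α))ᗮ, ∀ k,
      coeff (k + 1) x = (starRingEnd ℂ) α * coeff k x := by
    intro x hx k
    have h1 : monomialBasis (k + 1) - α • monomialBasis k ∈ mulRange (blaschkeFactor α) := by
      refine ⟨monomialBasis k - (starRingEnd ℂ) α • monomialBasis (k + 1), fun z hz => ?_⟩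
      have := one_sub_conj_mul_ne_zero hα hz.le
      simp only [eval_sub _ _ hz, eval_smul _ _ hz, eval_monomialBasis _ hz, blaschkeFactor]
      rw [div_mul_eq_mul_div, eq_div_iff this]
      ring
    have h2 := (Submodule.mem_orthogonal _ _).1 hx _ h1
    rw [inner_sub_left, inner_smul_left_eq, inner_monomialBasis, inner_monomialBasis, sub_eq_zero] at h2
    exact h2
  have hone : ∀ x : (mulRange (blaschkeFactor α))ᗮ,
      ∃ c : ℂ, c • (⟨κ, hmem⟩ : (mulRange (blaschkeFactor α))ᗮ) = x := by
    rintro ⟨x, hx⟩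
    refine ⟨coeff 0 x, Subtype.ext (ext_coeff fun k => ?_)⟩
    rw [Submodule.coe_smul, map_smul, hκ, smul_eq_mul]
    induction k with
    | zero => simp
    | succ k ih =>
      rw [hrec x hx, pow_succ]
      simp only at ih ⊢
      rw [← ih]; ring
  have hfin : Module.finrank ℂ (mulRange (blaschkeFactor α))ᗮ = 1 :=
    finrank_eq_one _ hne hone
  exact ⟨isIsometricMultiplier_blaschkeFactor hα, Module.finite_of_finrank_pos (by omega), hfin⟩

end Hardy2

/-! ### Finite Blaschke products as multipliers -/

theorem IsFiniteBlaschke.isInnerOfDegree {n : ℕ} {B : ℂ → ℂ} (hB : IsFiniteBlaschke n B) :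
    Hardy2.IsInnerOfDegree n B := by
  obtain ⟨c, α, hc, hα, hB⟩ := hB
  have key : ∀ (m : ℕ) (a : Fin m → ℂ), (∀ j, ‖a j‖ < 1) →
      Hardy2.IsInnerOfDegree m fun z => ∏ j, blaschkeFactor (a j) z := by
    intro m
    induction m with
    | zero => intro a _; simpa using Hardy2.IsInnerOfDegree.const (c := 1) (by simp)
    | succ m ih =>
      intro a ha
      have := (Hardy2.isInnerOfDegree_blaschkeFactor (ha 0)).mul (ih (fun j => a j.succ)
        fun j => ha j.succ)
      rw [add_comm 1 m] at this
      exact this.congr fun z _ => Fin.prod_univ_succ _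
  have := (Hardy2.IsInnerOfDegree.const hc).mul (key n α hα)
  rw [zero_add] at this
  exact this.congr hB

theorem IsFiniteBlaschke.norm_lt_one {n : ℕ} {B : ℂ → ℂ} (hB : IsFiniteBlaschke n B) (hn : 1 ≤ n)
    {z : ℂ} (hz : ‖z‖ < 1) : ‖B z‖ < 1 := by
  obtain ⟨c, α, hc, hα, hB⟩ := hB
  rw [hB z (by simpa using hz), norm_mul, hc, one_mul, norm_prod]
  have h1 : ∀ j, ‖(z - α j) / (1 - (starRingEnd ℂ) (α j) * z)‖ < 1 := fun j =>
    norm_blaschkeFactor_lt (hα j) hz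
  rw [← Finset.mul_prod_erase Finset.univ _ (Finset.mem_univ (⟨0, hn⟩ : Fin n))]
  refine mul_lt_one_of_nonneg_of_lt_one_left (norm_nonneg _) (h1 _) ?_
  exact Finset.prod_le_one (fun _ _ => norm_nonneg _) fun j _ => (h1 j).le

/-! ### The unitary operator built from the Wold basis -/

namespace Hardy2

/-- The monomials in the coordinates form a Hilbert basis of the direct sum of copies of `H²`. -/
theorem exists_hilbertBasis_piLp (n : ℕ) :
    ∃ b : HilbertBasis (Fin n × ℕ) ℂ (PiLp 2 fun _ : Fin n => Hardy2),
      ∀ f p, b.repr f p = coeff p.2 (f p.1) := by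
  have hin : ∀ (p : Fin n × ℕ) (f : PiLp 2 fun _ : Fin n => Hardy2),
      inner ℂ (PiLp.single 2 p.1 (monomialBasis p.2)) f = coeff p.2 (f p.1) := by
    intro p f
    rw [PiLp.inner_apply, Finset.sum_eq_single p.1]
    · simp only [PiLp.single_apply, if_true, inner_monomialBasis]
    · intro j _ hj
      simp [hj]
    · simp
  have ho : Orthonormal ℂ fun p : Fin n × ℕ =>
      (PiLp.single 2 p.1 (monomialBasis p.2) : PiLp 2 fun _ : Fin n => Hardy2) := by
    rw [orthonormal_iff_ite]
    rintro ⟨i, k⟩ ⟨j, l⟩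
    rw [hin]
    by_cases hij : i = j
    · subst hij; simp [coeff_monomialBasis]
    · simp [hij]
  refine ⟨HilbertBasis.mkOfOrthogonalEqBot ho ?_, fun f p => ?_⟩
  · rw [Submodule.eq_bot_iff]
    intro f hf
    ext1 j
    refine ext_coeff fun k => ?_
    refine (hin (j, k) f).symm.trans ?_
    change _ = coeff k 0
    rw [map_zero]
    exact (Submodule.mem_orthogonal _ _).1 hf _ (Submodule.subset_span ⟨(j, k), rfl⟩)
  · rw [HilbertBasis.repr_apply_apply, HilbertBasis.coe_mkOfOrthogonalEqBot]
    exact hin p f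

/-- For an isometric multiplier `B` with `|B| < 1` on the disk and an orthonormal basis `w` of
`(B H²)ᗮ`, the map `(f_j) ↦ ∑ w_j (f_j ∘ B)` is unitary. -/
theorem exists_unitary {n : ℕ} {B : ℂ → ℂ} (hB : IsIsometricMultiplier B)
    (hB1 : ∀ z : ℂ, ‖z‖ < 1 → ‖B z‖ < 1) (w : OrthonormalBasis (Fin n) ℂ (mulRange B)ᗮ) :
    ∃ U : PiLp 2 (fun _ : Fin n => Hardy2) ≃ₗᵢ[ℂ] Hardy2,
      ∀ (f : PiLp 2 (fun _ : Fin n => Hardy2)) (z : ℂ), ‖z‖ < 1 →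
        eval (U f) z = ∑ j, eval (w j) z * eval (f j) (B z) := by
  obtain ⟨b, hb⟩ := exists_hilbertBasis_piLp n
  -- If `x = B^k y` then `‖y‖ = ‖x‖`, so the point evaluation bound for `y` gives a bound for `x(z)`
  -- that decays like `|B(z)|^k`.
  have hpure : ∀ x, (∀ k, ∃ y, x = (hB.toIsometry ^ k) y) → x = 0 := by
    intro x hx
    refine ext_eval fun z hz => ?_
    rw [eval_zero]
    have hle : ∀ k : ℕ, ‖eval x z‖ ≤ ‖B z‖ ^ k * (‖x‖ * (1 - ‖z‖)⁻¹) := by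
      intro k
      obtain ⟨y, hy⟩ := hx k
      have hn : ‖x‖ = ‖y‖ := by rw [hy, LinearIsometry.norm_map]
      rw [hn]
      conv_lhs => rw [hy, hB.eval_toIsometry_pow k y hz, norm_mul, norm_pow]
      gcongr
      exact norm_eval_le y hz
    have hlim := (tendsto_pow_atTop_nhds_zero_of_lt_one (norm_nonneg _) (hB1 z hz)).mul_const
      (‖x‖ * (1 - ‖z‖)⁻¹)
    rw [zero_mul] at hlim
    exact norm_le_zero_iff.1 (ge_of_tendsto' hlim hle)
  obtain ⟨w', hw'⟩ : ∃ w' : OrthonormalBasis (Fin n) ℂ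
      ((LinearMap.range hB.toIsometry.toLinearMap)ᗮ : Submodule ℂ Hardy2),
      ∀ j, (w' j : Hardy2) = w j := by
    rw [hB.range_toIsometry]
    exact ⟨w, fun _ => rfl⟩
  obtain ⟨c, hc⟩ : ∃ c : HilbertBasis (Fin n × ℕ) ℂ Hardy2,
      ∀ p, c p = (hB.toIsometry ^ p.2) (w' p.1 : Hardy2) :=
    ⟨.mkOfOrthogonalEqBot (hB.toIsometry.orthonormal_pow_apply w')
      (hB.toIsometry.span_pow_apply_orthogonal w' hpure), fun p => by
        rw [HilbertBasis.coe_mkOfOrthogonalEqBot]⟩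
  refine ⟨b.repr.trans c.repr.symm, fun f z hz => ?_⟩
  -- Point evaluation is continuous, so it may be applied to the expansion in the `B^k w_j`. Summing
  -- over `k` first for fixed `j` gives the power series of `f j` at `B z`.
  have h1 := (c.hasSum_repr_symm (b.repr f)).mapL (evalCLM hz)
  simp only [evalCLM_apply, hc, hb, eval_smul _ _ hz,
    hB.eval_toIsometry_pow _ _ hz, hw'] at h1
  have h2 := h1.prod_fiberwise fun j => by
    have := (hasSum_eval (f j) (hB1 z hz)).mul_left (eval (w j) z)
    refine this.congr_fun fun k => ?_
    ring
  change eval (c.repr.symm (b.repr f)) z = _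
  exact h2.unique (hasSum_fintype _)

end Hardy2

/-! ### Approximate identities and Fatou's theorem: the dyadic estimate -/

/-- A family of kernels dominated by `2 δ / max δ d ^ 2` annihilates, as `δ → 0`, every function
whose averages over small balls tend to zero. -/
theorem tendsto_integral_mul_of_kernel_le {X : Type*} [PseudoMetricSpace X] [MeasurableSpace X]
    [OpensMeasurableSpace X] {μ : Measure X} {x : X} (hX : ∀ y, dist y x ≤ 1) {φ : X → ℝ}
    (hφ0 : ∀ y, 0 ≤ φ y) (hφ : Integrable φ μ)
    (hA : Tendsto (fun ρ : ℝ => ρ⁻¹ * ∫ y in Metric.closedBall x ρ, φ y ∂μ) (𝓝[>] 0) (𝓝 0))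
    {K : ℝ → X → ℝ} (hK0 : ∀ δ y, 0 < δ → δ < 1 → 0 ≤ K δ y)
    (hK1 : ∀ δ y, 0 < δ → δ < 1 → K δ y * δ ≤ 2)
    (hK2 : ∀ δ y, 0 < δ → δ < 1 → K δ y * dist y x ^ 2 ≤ 2 * δ) :
    Tendsto (fun δ => ∫ y, K δ y * φ y ∂μ) (𝓝[>] 0) (𝓝 0) := by
  set A : ℝ → ℝ := fun ρ => ρ⁻¹ * ∫ y in Metric.closedBall x ρ, φ y ∂μ with hAdef
  have hA0 : ∀ ρ, 0 < ρ → 0 ≤ A ρ := fun ρ hρ =>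
    mul_nonneg (inv_nonneg.2 hρ.le) (integral_nonneg fun y => hφ0 y)
  -- The hypothesis bounds `A` only near `0`; for larger radii the total integral of `φ` does. The
  -- uniform bound dominates the dyadic series below.
  obtain ⟨C, hC⟩ : ∃ C, ∀ ρ, 0 < ρ → A ρ ≤ C := by
    have h1 : ∀ᶠ ρ in 𝓝[>] (0 : ℝ), A ρ < 1 := hA.eventually (gt_mem_nhds one_pos)
    obtain ⟨ρ₀, hρ₀, h1⟩ := (mem_nhdsGT_iff_exists_Ioo_subset).1 h1
    have hρ₀ : 0 < ρ₀ := hρ₀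
    refine ⟨max 1 (ρ₀⁻¹ * ∫ y, φ y ∂μ), fun ρ hρ => ?_⟩
    rcases lt_or_ge ρ ρ₀ with h | h
    · exact (h1 ⟨hρ, h⟩ : A ρ < 1).le.trans (le_max_left _ _)
    · refine le_trans ?_ (le_max_right _ _)
      refine mul_le_mul (inv_anti₀ hρ₀ h) ?_ (integral_nonneg fun y => hφ0 y) (by positivity)
      exact setIntegral_le_integral hφ (Eventually.of_forall hφ0)
  -- The kernel is at most `8 · 4^(-j) / δ` on the `j`-th dyadic shell, and the integral of `φ` over
  -- the ball of radius `2^j δ` is `2^j δ A(2^j δ)`. The product leaves the weight `8 · 2^(-j)`.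
  have hgeo : Summable fun j : ℕ => 8 * (1 / 2 : ℝ) ^ j := summable_geometric_two.mul_left 8
  have hlim : Tendsto (fun δ => ∑' j : ℕ, 8 * (1 / 2 : ℝ) ^ j * A (2 ^ j * δ)) (𝓝[>] 0)
      (𝓝 (∑' j : ℕ, 8 * (1 / 2 : ℝ) ^ j * 0)) := by
    refine tendsto_tsum_of_dominated_convergence (hgeo.mul_right C) (fun j => ?_) ?_
    · refine (hA.comp ?_).const_mul _
      refine tendsto_nhdsWithin_iff.2 ⟨?_, ?_⟩
      · refine Tendsto.mono_left ?_ nhdsWithin_le_nhds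
        have : Continuous fun δ : ℝ => 2 ^ j * δ := by fun_prop
        simpa using this.tendsto 0
      · filter_upwards [self_mem_nhdsWithin] with δ hδ
        have hδ : 0 < δ := hδ
        exact (by positivity : 0 < 2 ^ j * δ)
    · filter_upwards [self_mem_nhdsWithin] with δ hδ j
      have hδ : 0 < 2 ^ j * δ := mul_pos (by positivity) hδ
      rw [Real.norm_of_nonneg (mul_nonneg (by positivity) (hA0 _ hδ))]
      gcongr
      exact hC _ hδ
  simp only [mul_zero, tsum_zero] at hlim
  refine tendsto_of_tendsto_of_tendsto_of_le_of_le' tendsto_const_nhds hlim ?_ ?_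
  · filter_upwards [Ioo_mem_nhdsGT (zero_lt_one (α := ℝ))] with δ hδ
    exact integral_nonneg fun y => mul_nonneg (hK0 _ _ hδ.1 hδ.2) (hφ0 y)
  · filter_upwards [Ioo_mem_nhdsGT (zero_lt_one (α := ℝ))] with δ hδ
    obtain ⟨hδ0, hδ1⟩ := hδ
    obtain ⟨J, hJ⟩ := pow_unbounded_of_one_lt δ⁻¹ (one_lt_two (α := ℝ))
    have hJ' : 1 ≤ 2 ^ J * δ := by
      rw [inv_lt_iff_one_lt_mul₀ hδ0] at hJ
      linarith
    have hpt : ∀ y, K δ y * φ y ≤ ∑ j ∈ Finset.range (J + 1), 8 * (1 / 4 : ℝ) ^ j * δ⁻¹ *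
        (Metric.closedBall x (2 ^ j * δ)).indicator φ y := by
      intro y
      have hex : ∃ j, dist y x ≤ 2 ^ j * δ := ⟨J, (hX y).trans hJ'⟩
      classical
      -- With `j` the first index whose ball contains `y`, minimality gives `dist y x > 2^(j-1) δ`
      -- when `j > 0`, and the quadratic bound yields `2δ / (4^(j-1) δ²) = 8 · 4^(-j) / δ`. For `j =
      -- 0` the bound `2 / δ` is enough.
      let j := Nat.find hex
      have hj : dist y x ≤ 2 ^ j * δ := Nat.find_spec hex
      have hjJ : j ∈ Finset.range (J + 1) :=
        Finset.mem_range_succ_iff.2 (Nat.find_min' hex ((hX y).trans hJ'))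
      have hK : K δ y ≤ 8 * (1 / 4 : ℝ) ^ j * δ⁻¹ := by
        rw [← div_eq_mul_inv, le_div_iff₀ hδ0]
        have hjc : j = 0 ∨ ∃ i, j = i + 1 := by
          rcases j with _ | i
          · exact Or.inl rfl
          · exact Or.inr ⟨i, rfl⟩
        rcases hjc with h0 | ⟨i, hi⟩
        · rw [h0]
          linarith [hK1 δ y hδ0 hδ1]
        · have hi' : 2 ^ i * δ < dist y x := not_le.1 (Nat.find_min hex (by omega : i < j))
          have h2 : K δ y * (2 ^ i * δ) ^ 2 ≤ 2 * δ :=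
            (mul_le_mul_of_nonneg_left (by gcongr) (hK0 δ y hδ0 hδ1)).trans (hK2 δ y hδ0 hδ1)
          rw [hi, pow_succ]
          have h4 : (0 : ℝ) < 4 ^ i := by positivity
          have h5 : (2 : ℝ) ^ i * 2 ^ i = 4 ^ i := by rw [← mul_pow]; norm_num
          have h3 : K δ y * δ * 4 ^ i ≤ 2 := by
            rw [← h5]
            refine le_of_mul_le_mul_right ?_ hδ0
            calc _ = K δ y * (2 ^ i * δ) ^ 2 := by ring
              _ ≤ _ := h2
          rw [← le_div_iff₀ h4] at h3
          refine h3.trans (le_of_eq ?_)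
          rw [one_div, inv_pow]
          field_simp
          norm_num
      refine le_trans ?_ (Finset.single_le_sum (f := fun j => 8 * (1 / 4 : ℝ) ^ j * δ⁻¹ *
        (Metric.closedBall x (2 ^ j * δ)).indicator φ y) (fun i _ => ?_) hjJ)
      · rw [Set.indicator_of_mem (by simpa using hj)]
        exact mul_le_mul_of_nonneg_right hK (hφ0 y)
      · exact mul_nonneg (by positivity) (Set.indicator_nonneg (fun y _ => hφ0 y) _)
    have hint : ∀ j ∈ Finset.range (J + 1), Integrable (fun y => 8 * (1 / 4 : ℝ) ^ j * δ⁻¹ *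
        (Metric.closedBall x (2 ^ j * δ)).indicator φ y) μ := fun j _ =>
      (hφ.indicator Metric.isClosed_closedBall.measurableSet).const_mul _
    calc ∫ y, K δ y * φ y ∂μ
        ≤ ∫ y, ∑ j ∈ Finset.range (J + 1), 8 * (1 / 4 : ℝ) ^ j * δ⁻¹ *
          (Metric.closedBall x (2 ^ j * δ)).indicator φ y ∂μ :=
          integral_mono_of_nonneg
            (Eventually.of_forall fun y => mul_nonneg (hK0 _ _ hδ0 hδ1) (hφ0 y))
            (integrable_finsetSum _ hint) (Eventually.of_forall hpt)
      _ = ∑ j ∈ Finset.range (J + 1), 8 * (1 / 2 : ℝ) ^ j * A (2 ^ j * δ) := by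
          rw [integral_finsetSum _ hint]
          refine Finset.sum_congr rfl fun j _ => ?_
          rw [integral_const_mul, integral_indicator Metric.isClosed_closedBall.measurableSet,
            hAdef]
          have : (1 / 4 : ℝ) ^ j = (1 / 2) ^ j * (2 ^ j)⁻¹ := by
            rw [← inv_pow, ← mul_pow]; norm_num
          rw [this]
          change _ = _ * ((2 ^ j * δ)⁻¹ * _)
          rw [mul_inv]; ring
      _ ≤ _ := by
          refine Summable.sum_le_tsum _ (fun j _ => ?_) ?_
          · exact mul_nonneg (by positivity) (hA0 _ (by positivity))
          · refine Summable.of_nonneg_of_le (fun j => ?_) (fun j => ?_) (hgeo.mul_right C)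
            · exact mul_nonneg (by positivity) (hA0 _ (by positivity))
            · gcongr
              exact hC _ (by positivity)

/-- The chord has length `2 |sin πy|` with `|y| ≤ 1/2` the distance on the circle, and Jordan's
inequality bounds the sine from below. The factor `2` absorbs a triangle inequality in the proof of
Fatou's theorem. -/
theorem UnitAddCircle.two_mul_norm_le_norm_toCircle_sub (s t : UnitAddCircle) :
    2 * dist s t ≤ ‖(toCircle s : ℂ) - toCircle t‖ := by
  have h1 : ‖(toCircle s : ℂ) - toCircle t‖ = ‖(toCircle (s - t) : ℂ) - 1‖ := by
    have : (toCircle s : ℂ) = toCircle (s - t) * toCircle t := by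
      rw [← Circle.coe_mul, ← toCircle_add, sub_add_cancel]
    rw [this, ← sub_one_mul, norm_mul, Circle.norm_coe, mul_one]
  rw [h1, dist_eq_norm]
  generalize s - t = u
  induction u using QuotientAddGroup.induction_on with
  | H x =>
    set y := x - round x with hy
    have hxy : ((x : ℝ) : UnitAddCircle) = (y : ℝ) := by
      rw [hy, AddCircle.coe_sub]
      have : ((round x : ℝ) : UnitAddCircle) = 0 := by
        rw [AddCircle.coe_eq_zero_iff]; exact ⟨round x, by simp⟩
      rw [this, sub_zero]
    have hyle : |y| ≤ 1 / 2 := abs_sub_round x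
    have hn : ‖((x : ℝ) : UnitAddCircle)‖ = |y| := UnitAddCircle.norm_eq
    have h2 : ‖(toCircle ((x : ℝ) : UnitAddCircle) : ℂ) - 1‖ = ‖2 * Real.sin (Real.pi * y)‖ := by
      rw [hxy, AddCircle.toCircle_apply_mk, Circle.coe_exp, mul_comm _ Complex.I,
        Complex.norm_exp_I_mul_ofReal_sub_one]
      congr 3
      ring
    change 2 * ‖((x : ℝ) : UnitAddCircle)‖ ≤ ‖(toCircle ((x : ℝ) : UnitAddCircle) : ℂ) - 1‖
    rw [hn, h2, norm_mul, Real.norm_eq_abs, Real.norm_eq_abs, abs_two]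
    have h3 := Real.mul_abs_le_abs_sin (x := Real.pi * y) (by
      rw [abs_mul, abs_of_pos Real.pi_pos]
      nlinarith [Real.pi_pos])
    rw [abs_mul, abs_of_pos Real.pi_pos, ← mul_assoc, div_mul_cancel₀ _ Real.pi_pos.ne'] at h3
    linarith [abs_nonneg y]

theorem UnitAddCircle.haar_eq_volume :
    (haarAddCircle : Measure UnitAddCircle) = volume := by
  have := volume_eq_smul_haarAddCircle (T := (1 : ℝ))
  rw [this]; simp

/-! ### Herglotz, Cauchy and Poisson integrals -/

/-- The Herglotz kernel of the disk. -/
noncomputable def herglotz (z : ℂ) (t : UnitAddCircle) : ℂ :=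
  ((toCircle t : ℂ) + z) / ((toCircle t : ℂ) - z)

/-- The Poisson kernel of the disk. -/
noncomputable def poisson (z : ℂ) (t : UnitAddCircle) : ℝ := (herglotz z t).re

theorem toCircle_sub_ne_zero {z : ℂ} (hz : ‖z‖ < 1) (t : UnitAddCircle) :
    (toCircle t : ℂ) - z ≠ 0 := by
  intro h
  rw [sub_eq_zero] at h
  rw [← h, Circle.norm_coe] at hz
  exact lt_irrefl _ hz

theorem one_sub_norm_le_norm_toCircle_sub (z : ℂ) (t : UnitAddCircle) :
    1 - ‖z‖ ≤ ‖(toCircle t : ℂ) - z‖ := by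
  have := norm_sub_norm_le (toCircle t : ℂ) z
  rwa [Circle.norm_coe] at this

theorem poisson_eq (z : ℂ) (t : UnitAddCircle) :
    poisson z t = (1 - ‖z‖ ^ 2) / ‖(toCircle t : ℂ) - z‖ ^ 2 := by
  have := congrFun (poissonKernel_eq_re_herglotzRieszKernel (c := 0) (w := z)) (toCircle t : ℂ)
  simp only [poissonKernel, sub_zero, Circle.norm_coe, one_pow, Function.comp_apply,
    herglotzRieszKernel] at this
  exact this.symm

theorem poisson_pos {z : ℂ} (hz : ‖z‖ < 1) (t : UnitAddCircle) : 0 < poisson z t := by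
  rw [poisson_eq]
  have h1 : 0 < 1 - ‖z‖ ^ 2 := by nlinarith [norm_nonneg z]
  have h2 := norm_pos_iff.2 (toCircle_sub_ne_zero hz t)
  positivity

theorem continuous_toCircle_coe : Continuous fun t : UnitAddCircle => (toCircle t : ℂ) :=
  continuous_subtype_val.comp AddCircle.continuous_toCircle

theorem continuous_herglotz {z : ℂ} (hz : ‖z‖ < 1) : Continuous (herglotz z) :=
  (continuous_toCircle_coe.add continuous_const).div (continuous_toCircle_coe.sub continuous_const)
    (toCircle_sub_ne_zero hz)

theorem continuous_poisson {z : ℂ} (hz : ‖z‖ < 1) : Continuous (poisson z) :=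
  Complex.continuous_re.comp (continuous_herglotz hz)

theorem MeasureTheory.Integrable.continuous_smul_addCircle {E : Type*}
    [NormedAddCommGroup E] [NormedSpace ℝ E] {k : UnitAddCircle → E}
    (hk : Integrable k haarAddCircle) {p : UnitAddCircle → ℝ} (hp : Continuous p) :
    Integrable (fun t => p t • k t) haarAddCircle := by
  obtain ⟨M, hM⟩ := isCompact_univ.exists_bound_of_continuousOn hp.continuousOn
  exact hk.bdd_smul M hp.aestronglyMeasurable (Eventually.of_forall fun t => hM t trivial)

theorem MeasureTheory.Integrable.continuous_mul_addCircle {k : UnitAddCircle → ℂ}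
    (hk : Integrable k haarAddCircle) {p : UnitAddCircle → ℂ} (hp : Continuous p) :
    Integrable (fun t => p t * k t) haarAddCircle := by
  obtain ⟨M, hM⟩ := isCompact_univ.exists_bound_of_continuousOn hp.continuousOn
  exact hk.bdd_mul hp.aestronglyMeasurable (Eventually.of_forall fun t => hM t trivial)

/-- Expand the kernel as a geometric series in `z` times the conjugate of `ζ = toCircle t` and
integrate termwise; the integrals of the norms form a geometric series. -/
theorem hasSum_cauchy {k : UnitAddCircle → ℂ} (hk : Integrable k haarAddCircle) {z : ℂ}
    (hz : ‖z‖ < 1) :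
    HasSum (fun j : ℕ => fourierCoeff k j * z ^ j)
      (∫ t, (1 - z * (starRingEnd ℂ) (toCircle t : ℂ))⁻¹ * k t ∂haarAddCircle) := by
  have hF : ∀ j : ℕ, (fun t => (z * (starRingEnd ℂ) (toCircle t : ℂ)) ^ j * k t) =
      fun t => z ^ j * (fourier (-(j : ℤ)) t • k t) := by
    intro j; funext t
    rw [fourier_neg, fourier_apply, natCast_zsmul, toCircle_nsmul, Circle.coe_pow, mul_pow, map_pow,
      smul_eq_mul, mul_assoc]
  have hint : ∀ j : ℕ, Integrable (fun t => (z * (starRingEnd ℂ) (toCircle t : ℂ)) ^ j * k t)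
      haarAddCircle := fun j => by
    rw [hF]; exact (hk.fourier_smul _).const_mul _
  have hn : ∀ t : UnitAddCircle, ‖z * (starRingEnd ℂ) (toCircle t : ℂ)‖ = ‖z‖ := fun t => by
    rw [norm_mul, Complex.norm_conj, Circle.norm_coe, mul_one]
  have h := hasSum_integral_of_summable_integral_norm hint (by
    simp only [norm_mul, norm_pow, Complex.norm_conj, Circle.norm_coe, mul_one, integral_const_mul]
    exact (summable_geometric_of_lt_one (norm_nonneg _) hz).mul_right _)
  have e1 : ∀ j : ℕ, ∫ t, (z * (starRingEnd ℂ) (toCircle t : ℂ)) ^ j * k t ∂haarAddCircle =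
      fourierCoeff k j * z ^ j := fun j => by
    rw [hF, integral_const_mul, mul_comm]; rfl
  have e2 : ∀ t, ∑' j : ℕ, (z * (starRingEnd ℂ) (toCircle t : ℂ)) ^ j * k t =
      (1 - z * (starRingEnd ℂ) (toCircle t : ℂ))⁻¹ * k t := fun t => by
    rw [tsum_mul_right, tsum_geometric_of_norm_lt_one (by rw [hn]; exact hz)]
  simpa only [e1, e2] using h

theorem continuous_cauchy {z : ℂ} (hz : ‖z‖ < 1) :
    Continuous fun t : UnitAddCircle => (1 - z * (starRingEnd ℂ) (toCircle t : ℂ))⁻¹ := by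
  refine Continuous.inv₀ ?_ fun t h => ?_
  · exact continuous_const.sub (continuous_const.mul (Complex.continuous_conj.comp
      continuous_toCircle_coe))
  · rw [sub_eq_zero] at h
    have := congrArg norm h
    rw [norm_one, norm_mul, Complex.norm_conj, Circle.norm_coe, mul_one] at this
    linarith

/-- On the circle the conjugate of `ζ` is `1 / ζ`. This reduces Herglotz and Poisson integrals to
power series with Fourier coefficients. -/
theorem herglotz_eq_cauchy {z : ℂ} (hz : ‖z‖ < 1) (t : UnitAddCircle) :
    herglotz z t = 2 * (1 - z * (starRingEnd ℂ) (toCircle t : ℂ))⁻¹ - 1 := by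
  have h0 := toCircle_sub_ne_zero hz t
  have h1 : (toCircle t : ℂ) * (starRingEnd ℂ) (toCircle t : ℂ) = 1 := by
    rw [Complex.mul_conj, Complex.normSq_eq_norm_sq, Circle.norm_coe]; simp
  have hne : 1 - z * (starRingEnd ℂ) (toCircle t : ℂ) ≠ 0 := fun h => by
    apply h0
    linear_combination (toCircle t : ℂ) * h + z * h1
  have h2 : (1 - z * (starRingEnd ℂ) (toCircle t : ℂ))⁻¹ =
      (toCircle t : ℂ) / ((toCircle t : ℂ) - z) := by
    rw [inv_eq_one_div, div_eq_div_iff hne h0]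
    linear_combination z * h1
  rw [h2, herglotz]
  field_simp
  ring

theorem integral_herglotz {k : UnitAddCircle → ℂ} (hk : Integrable k haarAddCircle) {z : ℂ}
    (hz : ‖z‖ < 1) :
    ∫ t, herglotz z t * k t ∂haarAddCircle =
      2 * (∑' j : ℕ, fourierCoeff k j * z ^ j) - ∫ t, k t ∂haarAddCircle := by
  rw [(hasSum_cauchy hk hz).tsum_eq, ← integral_const_mul, ← integral_sub _ hk]
  · refine integral_congr_ae (Eventually.of_forall fun t => ?_)
    simp only [herglotz_eq_cauchy hz]
    ring
  · exact (hk.continuous_mul_addCircle (continuous_cauchy hz)).const_mul 2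

theorem differentiableOn_tsum_pow {c : ℕ → ℂ} {C : ℝ} (hc : ∀ j, ‖c j‖ ≤ C) :
    DifferentiableOn ℂ (fun z => ∑' j : ℕ, c j * z ^ j) (Metric.ball 0 1) := by
  intro z hz
  rw [mem_ball_zero_iff] at hz
  obtain ⟨r, hr, hr1⟩ := exists_between hz
  have hr0 : 0 ≤ r := (norm_nonneg z).trans hr.le
  have : DifferentiableOn ℂ (fun z => ∑' j : ℕ, c j * z ^ j) (Metric.ball 0 r) := by
    refine Complex.differentiableOn_tsum_of_summable_norm
      ((summable_geometric_of_lt_one hr0 hr1).mul_left C) (fun k => by fun_prop)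
      Metric.isOpen_ball ?_
    intro k w hw
    rw [mem_ball_zero_iff] at hw
    rw [norm_mul, norm_pow]
    gcongr
    · exact (norm_nonneg _).trans (hc 0)
    · exact hc k
  exact (this.differentiableAt (Metric.isOpen_ball.mem_nhds (by simpa using hr)))
    |>.differentiableWithinAt

theorem norm_fourierCoeff_le {k : UnitAddCircle → ℂ} (j : ℤ) :
    ‖fourierCoeff k j‖ ≤ ∫ t, ‖k t‖ ∂haarAddCircle := by
  refine (norm_integral_le_integral_norm _).trans (le_of_eq ?_)
  congr 1
  funext t
  rw [norm_smul, fourier_apply, Circle.norm_coe, one_mul]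

/-- The Herglotz integral is, up to a constant, a power series whose coefficients are bounded by the
`L¹` norm of `k`, so there is no need to differentiate under the integral sign. -/
theorem differentiableOn_integral_herglotz {k : UnitAddCircle → ℂ}
    (hk : Integrable k haarAddCircle) :
    DifferentiableOn ℂ (fun z => ∫ t, herglotz z t * k t ∂haarAddCircle) (Metric.ball 0 1) := by
  have h := ((differentiableOn_tsum_pow (c := fun j : ℕ => fourierCoeff k j)
    fun j => norm_fourierCoeff_le j).const_mul 2).sub_const (∫ t, k t ∂haarAddCircle)
  exact h.congr fun z hz => integral_herglotz hk (by simpa using hz)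

theorem re_integral_herglotz {k : UnitAddCircle → ℝ} (hk : Integrable k haarAddCircle) {z : ℂ}
    (hz : ‖z‖ < 1) :
    (∫ t, herglotz z t * (k t : ℂ) ∂haarAddCircle).re = ∫ t, poisson z t * k t ∂haarAddCircle := by
  have hk' : Integrable (fun t => (k t : ℂ)) haarAddCircle := hk.ofReal
  have h := hk'.continuous_mul_addCircle (continuous_herglotz hz)
  have := Complex.reCLM.integral_comp_comm h
  simp only [Complex.reCLM_apply, Complex.re_mul_ofReal] at this
  exact this.symm

theorem poisson_eq_cauchy {z : ℂ} (hz : ‖z‖ < 1) (t : UnitAddCircle) :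
    (poisson z t : ℂ) = (1 - z * (starRingEnd ℂ) (toCircle t : ℂ))⁻¹ +
      (starRingEnd ℂ) (1 - z * (starRingEnd ℂ) (toCircle t : ℂ))⁻¹ - 1 := by
  rw [poisson, Complex.re_eq_add_conj, herglotz_eq_cauchy hz]
  simp only [map_sub, map_mul, map_one, Complex.conj_ofNat]
  ring

/-- The Poisson formula: if the Fourier coefficients of negative index vanish, the Poisson integral
is the power series. -/
theorem integral_poisson_of_fourierCoeff {f : UnitAddCircle → ℂ} (hf : Integrable f haarAddCircle)
    (h0 : ∀ k : ℤ, k < 0 → fourierCoeff f k = 0) {z : ℂ} (hz : ‖z‖ < 1) :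
    ∫ t, (poisson z t : ℂ) * f t ∂haarAddCircle = ∑' j : ℕ, fourierCoeff f j * z ^ j := by
  have hc := continuous_cauchy hz
  have i1 := hf.continuous_mul_addCircle hc
  have i2 := hf.continuous_mul_addCircle (Complex.continuous_conj.comp hc)
  -- The conjugate Cauchy kernel only sees the Fourier coefficients of index `≤ 0`. All but the one
  -- of index `0` vanish, and the resulting mean cancels against the `-1` in the Poisson kernel.
  have hconj : ∫ t, (starRingEnd ℂ) (1 - z * (starRingEnd ℂ) (toCircle t : ℂ))⁻¹ * f t
      ∂haarAddCircle = ∫ t, f t ∂haarAddCircle := by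
    have hfc : Integrable (fun t => (starRingEnd ℂ) (f t)) haarAddCircle :=
      (Complex.conjCLE.toContinuousLinearMap.integrable_comp hf)
    have hcoef : ∀ j : ℕ, fourierCoeff (fun t => (starRingEnd ℂ) (f t)) (j : ℤ) =
        (starRingEnd ℂ) (fourierCoeff f (-(j : ℤ))) := by
      intro j
      simp only [fourierCoeff]
      rw [← integral_conj]
      congr 1
      funext t
      simp only [smul_eq_mul, map_mul, fourier_neg, neg_neg]
    have h1 := hasSum_cauchy hfc hz
    have h2 := h1.unique (hasSum_single 0 fun j hj => by
      rw [hcoef, h0 _ (by omega), map_zero, zero_mul])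
    rw [hcoef, pow_zero, mul_one] at h2
    have h3 := congrArg (starRingEnd ℂ) h2
    rw [← integral_conj, Complex.conj_conj] at h3
    simp only [map_mul, Complex.conj_conj] at h3
    rw [h3]
    simp [fourierCoeff]
  have e : ∀ t, (poisson z t : ℂ) * f t = (1 - z * (starRingEnd ℂ) (toCircle t : ℂ))⁻¹ * f t +
      (starRingEnd ℂ) (1 - z * (starRingEnd ℂ) (toCircle t : ℂ))⁻¹ * f t - f t := fun t => by
    rw [poisson_eq_cauchy hz]; ring
  have e2 := integral_sub (i1.add i2) hf
  rw [integral_add' i1 i2] at e2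
  rw [integral_congr_ae (Eventually.of_forall e)]
  refine e2.trans ?_
  rw [(hasSum_cauchy hf hz).tsum_eq]
  simp only [Function.comp_apply]
  rw [hconj]
  ring

theorem integral_poisson {z : ℂ} (hz : ‖z‖ < 1) : ∫ t, poisson z t ∂haarAddCircle = 1 := by
  have h1 : ∀ j : ℤ, fourierCoeff (fun _ : UnitAddCircle => (1 : ℂ)) j = if j = 0 then 1 else 0 := by
    intro j
    have : (fun _ : UnitAddCircle => (1 : ℂ)) = fourier 0 := by funext t; simp
    rw [this, fourierCoeff_fourier, Pi.single_apply]
  have h := integral_poisson_of_fourierCoeff (f := fun _ => 1) (integrable_const _)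
    (fun k hk => by rw [h1, if_neg hk.ne]) hz
  rw [tsum_eq_single 0 fun j hj => by rw [h1, if_neg (by omega), zero_mul], h1] at h
  simp only [mul_one, if_true, Nat.cast_zero, pow_zero] at h
  rw [integral_complex_ofReal] at h
  exact_mod_cast h

/-- Fatou's theorem: the Poisson integral of an integrable function has radial limits almost
everywhere. -/
theorem ae_tendsto_integral_poisson {E : Type*} [NormedAddCommGroup E] [NormedSpace ℝ E]
    [CompleteSpace E] {k : UnitAddCircle → E} (hk : Integrable k haarAddCircle) :
    ∀ᵐ t ∂haarAddCircle, Tendsto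
      (fun r : ℝ => ∫ s, poisson (r * (toCircle t : ℂ)) s • k s ∂haarAddCircle) (𝓝[<] 1)
      (𝓝 (k t)) := by
  -- Radial convergence is proved at every Lebesgue point of `k`, where the mean oscillation over
  -- shrinking balls tends to zero.
  have hleb := IsUnifLocDoublingMeasure.ae_tendsto_average_norm_sub
    (μ := (volume : Measure UnitAddCircle))
    (UnitAddCircle.haar_eq_volume ▸ hk).locallyIntegrable 1
  rw [← UnitAddCircle.haar_eq_volume] at hleb
  filter_upwards [hleb] with t ht
  have hφ : Integrable (fun s => ‖k s - k t‖) haarAddCircle := (hk.sub (integrable_const _)).norm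
  have hA : Tendsto (fun ρ : ℝ => ρ⁻¹ * ∫ s in Metric.closedBall t ρ, ‖k s - k t‖ ∂haarAddCircle)
      (𝓝[>] 0) (𝓝 0) := by
    have h1 := ht (fun _ : ℝ => t) id tendsto_id (by
      filter_upwards [self_mem_nhdsWithin] with ρ hρ
      have hρ : 0 < ρ := hρ
      simp [hρ.le])
    have h2 := h1.const_mul 2
    rw [mul_zero] at h2
    refine tendsto_of_tendsto_of_tendsto_of_le_of_le' tendsto_const_nhds h2 ?_ ?_
    · filter_upwards [self_mem_nhdsWithin] with ρ hρ
      have hρ : 0 < ρ := hρ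
      exact mul_nonneg (by positivity) (integral_nonneg fun _ => norm_nonneg _)
    · filter_upwards [self_mem_nhdsWithin] with ρ hρ
      have hρ : 0 < ρ := hρ
      have h3 := measure_smul_setAverage (μ := (haarAddCircle : Measure UnitAddCircle))
        (fun s => ‖k s - k t‖) (measure_ne_top _ (Metric.closedBall t ρ))
      have h4 : (haarAddCircle : Measure UnitAddCircle).real (Metric.closedBall t ρ) ≤ 2 * ρ := by
        rw [measureReal_def, UnitAddCircle.haar_eq_volume, AddCircle.volume_closedBall]
        rw [ENNReal.toReal_ofReal (by positivity)]
        exact min_le_right _ _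
      have h5 : 0 ≤ ⨍ s in Metric.closedBall t ρ, ‖k s - k t‖ ∂haarAddCircle :=
        integral_nonneg fun _ => norm_nonneg _
      rw [← h3, smul_eq_mul, ← mul_assoc]
      refine mul_le_mul_of_nonneg_right ?_ h5
      rw [inv_mul_le_iff₀ hρ]
      linarith
  -- The parameter of the kernel family is `δ = 1 - r`, the distance from the radial point to the
  -- circle.
  have hlim := tendsto_integral_mul_of_kernel_le (x := t)
    (K := fun δ s => poisson (((1 - δ : ℝ) : ℂ) * (toCircle t : ℂ)) s)
    (φ := fun s => ‖k s - k t‖) (μ := haarAddCircle) ?_ (fun _ => norm_nonneg _) hφ hA ?_ ?_ ?_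
  · have hδ : Tendsto (fun r : ℝ => 1 - r) (𝓝[<] 1) (𝓝[>] 0) := by
      refine tendsto_nhdsWithin_iff.2 ⟨?_, ?_⟩
      · refine Tendsto.mono_left ?_ nhdsWithin_le_nhds
        have : Continuous fun r : ℝ => 1 - r := by fun_prop
        simpa using this.tendsto 1
      · filter_upwards [self_mem_nhdsWithin] with r hr
        exact sub_pos.2 (show r < 1 from hr)
    have h2 := hlim.comp hδ
    rw [tendsto_iff_norm_sub_tendsto_zero]
    refine squeeze_zero' (Eventually.of_forall fun _ => norm_nonneg _) ?_ h2
    filter_upwards [Ioo_mem_nhdsLT (zero_lt_one (α := ℝ))] with r hr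
    have hz : ‖(r : ℂ) * (toCircle t : ℂ)‖ < 1 := by
      rw [norm_mul, Circle.norm_coe, mul_one, Complex.norm_real, Real.norm_of_nonneg hr.1.le]
      exact hr.2
    have hp := continuous_poisson hz
    have e1 : (∫ s, poisson (r * (toCircle t : ℂ)) s • k s ∂haarAddCircle) - k t =
        ∫ s, poisson (r * (toCircle t : ℂ)) s • (k s - k t) ∂haarAddCircle := by
      simp only [smul_sub]
      rw [integral_sub (hk.continuous_smul_addCircle hp)
        ((integrable_const _).continuous_smul_addCircle hp), integral_smul_const,
        integral_poisson hz, one_smul]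
    rw [e1]
    refine (norm_integral_le_integral_norm _).trans (le_of_eq ?_)
    simp only [Function.comp_apply, sub_sub_cancel]
    congr 1
    funext s
    rw [norm_smul, Real.norm_of_nonneg (poisson_pos hz s).le]
  · intro s
    have h1 := UnitAddCircle.two_mul_norm_le_norm_toCircle_sub s t
    have h2 := norm_sub_le (toCircle s : ℂ) (toCircle t)
    rw [Circle.norm_coe, Circle.norm_coe] at h2
    linarith
  all_goals
    intro δ s h0 h1
    have hn : ‖((1 - δ : ℝ) : ℂ) * (toCircle t : ℂ)‖ = 1 - δ := by
      rw [norm_mul, Circle.norm_coe, mul_one, Complex.norm_real, Real.norm_of_nonneg (by linarith)]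
    have hz : ‖((1 - δ : ℝ) : ℂ) * (toCircle t : ℂ)‖ < 1 := by rw [hn]; linarith
  · exact (poisson_pos hz s).le
  all_goals
    have hd := one_sub_norm_le_norm_toCircle_sub (((1 - δ : ℝ) : ℂ) * (toCircle t : ℂ)) s
    rw [hn] at hd
    have hpos := norm_pos_iff.2 (toCircle_sub_ne_zero hz s)
    rw [poisson_eq, hn]
    set D := ‖(toCircle s : ℂ) - ((1 - δ : ℝ) : ℂ) * (toCircle t : ℂ)‖ with hD
  · rw [div_mul_eq_mul_div, div_le_iff₀ (by positivity)]
    have h3 : δ ^ 2 ≤ D ^ 2 := by gcongr; linarith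
    nlinarith
  -- The distance `D` from the radial point is at least `δ`, so the chord from `s` to `t` is at most
  -- `2 D`. It is also at least `2 dist s t`, which leaves `dist s t ≤ D`.
  · have h3 : ‖(toCircle s : ℂ) - toCircle t‖ ≤ D + δ := by
      have := norm_sub_le_norm_sub_add_norm_sub (toCircle s : ℂ)
        (((1 - δ : ℝ) : ℂ) * (toCircle t : ℂ)) (toCircle t)
      refine this.trans (add_le_add le_rfl (le_of_eq ?_))
      rw [← sub_one_mul, norm_mul, Circle.norm_coe, mul_one]
      push_cast
      rw [sub_right_comm, sub_self, zero_sub, norm_neg, Complex.norm_real,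
        Real.norm_of_nonneg h0.le]
    have h4 := UnitAddCircle.two_mul_norm_le_norm_toCircle_sub s t
    have h5 : dist s t ≤ D := by linarith
    rw [div_mul_eq_mul_div, div_le_iff₀ (by positivity)]
    have h6 : dist s t ^ 2 ≤ D ^ 2 := by gcongr
    have h7 : 1 - (1 - δ) ^ 2 ≤ 2 * δ := by nlinarith
    have h8 : 0 ≤ 1 - (1 - δ) ^ 2 := by nlinarith
    exact mul_le_mul h7 h6 (by positivity) (by positivity)

/-! ### Boundary functions -/

theorem eventually_radial_mem_ball (t : UnitAddCircle) :
    ∀ᶠ r : ℝ in 𝓝[<] 1, (r : ℂ) * (toCircle t : ℂ) ∈ Metric.ball (0 : ℂ) 1 := by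
  filter_upwards [Ioo_mem_nhdsLT (zero_lt_one (α := ℝ))] with r hr
  rw [mem_ball_zero_iff, norm_mul, Circle.norm_coe, mul_one, Complex.norm_real,
    Real.norm_of_nonneg hr.1.le]
  exact hr.2

theorem HasRadialLimit.congr {φ ψ : ℂ → ℂ} {t : UnitAddCircle} {l : ℂ} (h : HasRadialLimit φ t l)
    (he : ∀ z ∈ Metric.ball (0 : ℂ) 1, ψ z = φ z) : HasRadialLimit ψ t l := by
  refine Tendsto.congr' ?_ h
  filter_upwards [eventually_radial_mem_ball t] with r hr
  exact (he _ hr).symm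

theorem HasRadialLimit.of_continuousAt {φ : ℂ → ℂ} {t : UnitAddCircle}
    (h : ContinuousAt φ (toCircle t : ℂ)) : HasRadialLimit φ t (φ (toCircle t)) := by
  refine h.tendsto.comp (Tendsto.mono_left ?_ nhdsWithin_le_nhds)
  have : Continuous fun r : ℝ => (r : ℂ) * (toCircle t : ℂ) := by fun_prop
  simpa using this.tendsto 1

/-- The Poisson integral formula and the existence of radial limits for bounded analytic
functions. -/
theorem IsHInfty.exists_boundary {φ : ℂ → ℂ} (hφ : IsHInfty φ) :
    ∃ F : UnitAddCircle → ℂ, Integrable F haarAddCircle ∧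
      (∀ z : ℂ, ‖z‖ < 1 → φ z = ∫ t, poisson z t • F t ∂haarAddCircle) ∧
      ∀ᵐ t ∂haarAddCircle, HasRadialLimit φ t (F t) := by
  -- Multiplying the constant `1` by `φ` realizes `φ` itself as an element of `H²`, whose `L²`
  -- function serves as boundary function.
  obtain ⟨f, hf⟩ := Hardy2.exists_mul φ hφ.1 hφ.2 (Hardy2.monomialBasis 0)
  have hint : Integrable (f : Lp ℂ 2 (haarAddCircle : Measure UnitAddCircle)) haarAddCircle :=
    (Lp.memLp _).integrable one_le_two
  have hpoi : ∀ z : ℂ, ‖z‖ < 1 → φ z = ∫ t, poisson z t •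
      (f : Lp ℂ 2 (haarAddCircle : Measure UnitAddCircle)) t ∂haarAddCircle := by
    intro z hz
    simp only [Complex.real_smul]
    rw [integral_poisson_of_fourierCoeff hint f.2 hz]
    have := hf z hz
    rw [Hardy2.eval_monomialBasis 0 hz, pow_zero, mul_one] at this
    exact this.symm
  refine ⟨_, hint, hpoi, ?_⟩
  filter_upwards [ae_tendsto_integral_poisson hint] with t ht
  refine Tendsto.congr' ?_ ht
  filter_upwards [eventually_radial_mem_ball t] with r hr
  exact (hpoi _ (by simpa using hr)).symm

/-- Radial limits are unique, so any known boundary values may be used in the Poisson formula. Below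
they are the explicit boundary values of `B^j` and of `z^j`. -/
theorem IsHInfty.eq_integral_poisson {φ : ℂ → ℂ} (hφ : IsHInfty φ) {G : UnitAddCircle → ℂ}
    (hG : ∀ᵐ t ∂haarAddCircle, HasRadialLimit φ t (G t)) {z : ℂ} (hz : ‖z‖ < 1) :
    φ z = ∫ t, poisson z t • G t ∂haarAddCircle := by
  obtain ⟨F, -, h2, h3⟩ := hφ.exists_boundary
  rw [h2 z hz]
  refine integral_congr_ae ?_
  filter_upwards [h3, hG] with t h h'
  rw [tendsto_nhds_unique h h']

/-- The maximum principle in terms of the boundary values. -/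
theorem IsHInfty.norm_le_of_ae {φ : ℂ → ℂ} (hφ : IsHInfty φ) {M : ℝ}
    (hM : ∀ᵐ t ∂haarAddCircle, ∃ l, HasRadialLimit φ t l ∧ ‖l‖ ≤ M) {z : ℂ} (hz : ‖z‖ < 1) :
    ‖φ z‖ ≤ M := by
  obtain ⟨F, -, h2, h3⟩ := hφ.exists_boundary
  rw [h2 z hz]
  have hp : Integrable (poisson z) (haarAddCircle : Measure UnitAddCircle) := by
    simpa using (integrable_const (1 : ℝ)).continuous_smul_addCircle (continuous_poisson hz)
  calc _ ≤ ∫ t, poisson z t * M ∂haarAddCircle := by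
        refine norm_integral_le_of_norm_le (hp.mul_const M) ?_
        filter_upwards [hM, h3] with t ⟨l, h, hl⟩ h'
        rw [tendsto_nhds_unique h' h, norm_smul, Real.norm_of_nonneg (poisson_pos hz t).le]
        exact mul_le_mul_of_nonneg_left hl (poisson_pos hz t).le
    _ = M := by rw [integral_mul_const, integral_poisson hz, one_mul]

/-! ### The measure with the Poisson kernel as density -/

/-- Harmonic measure of the disk. -/
noncomputable def poissonMeasure (z : ℂ) : Measure UnitAddCircle :=
  haarAddCircle.withDensity fun t => ENNReal.ofReal (poisson z t)

theorem measurable_ofReal_poisson {z : ℂ} (hz : ‖z‖ < 1) :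
    Measurable fun t => ENNReal.ofReal (poisson z t) :=
  (continuous_poisson hz).measurable.ennreal_ofReal

theorem integral_poissonMeasure {E : Type*} [NormedAddCommGroup E] [NormedSpace ℝ E] {z : ℂ}
    (hz : ‖z‖ < 1) (k : UnitAddCircle → E) :
    ∫ t, k t ∂(poissonMeasure z) = ∫ t, poisson z t • k t ∂haarAddCircle := by
  rw [poissonMeasure, integral_withDensity_eq_integral_toReal_smul (measurable_ofReal_poisson hz)
    (Eventually.of_forall fun _ => ENNReal.ofReal_lt_top)]
  simp only [ENNReal.toReal_ofReal (poisson_pos hz _).le]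

/-- The Poisson kernel is continuous and strictly positive on the compact circle, so both it and its
inverse are bounded. -/
theorem integrable_poissonMeasure_iff {E : Type*} [NormedAddCommGroup E] [NormedSpace ℝ E] {z : ℂ}
    (hz : ‖z‖ < 1) {k : UnitAddCircle → E} :
    Integrable k (poissonMeasure z) ↔ Integrable k haarAddCircle := by
  rw [poissonMeasure, integrable_withDensity_iff_integrable_smul' (measurable_ofReal_poisson hz)
    (Eventually.of_forall fun _ => ENNReal.ofReal_lt_top)]
  simp only [ENNReal.toReal_ofReal (poisson_pos hz _).le]
  refine ⟨fun h => ?_, fun h => h.continuous_smul_addCircle (continuous_poisson hz)⟩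
  have := h.continuous_smul_addCircle
    ((continuous_poisson hz).inv₀ fun t => (poisson_pos hz t).ne')
  refine this.congr (Eventually.of_forall fun t => ?_)
  simp only [Pi.inv_apply]
  rw [inv_smul_smul₀ (poisson_pos hz t).ne']

theorem poissonMeasure_zero : poissonMeasure 0 = haarAddCircle := by
  have : ∀ t, poisson 0 t = 1 := fun t => by
    rw [poisson_eq, sub_zero, Circle.norm_coe]; simp
  simp [poissonMeasure, this]

theorem isFiniteMeasure_poissonMeasure {z : ℂ} (hz : ‖z‖ < 1) :
    IsFiniteMeasure (poissonMeasure z) := by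
  have := (integrable_poissonMeasure_iff hz).2 (integrable_const (1 : ℝ))
  exact (integrable_const_iff.1 this).resolve_left one_ne_zero

theorem exists_integralCLM (μ : Measure UnitAddCircle) [IsFiniteMeasure μ] :
    ∃ L : C(UnitAddCircle, ℂ) →L[ℂ] ℂ, ∀ f, L f = ∫ t, f t ∂μ := by
  have hi : ∀ f : C(UnitAddCircle, ℂ), Integrable f μ := fun f =>
    Integrable.of_bound f.continuous.aestronglyMeasurable ‖f‖
      (Eventually.of_forall f.norm_coe_le_norm)
  refine ⟨LinearMap.mkContinuous
    { toFun := fun f => ∫ t, f t ∂μ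
      map_add' := fun f g => integral_add (hi f) (hi g)
      map_smul' := fun c f => integral_smul c f } (μ.real Set.univ) fun f => ?_, fun f => rfl⟩
  rw [mul_comm]
  exact norm_integral_le_of_norm_le_const (Eventually.of_forall f.norm_coe_le_norm)

/-- Finite measures on the circle are determined by their Fourier coefficients. -/
theorem MeasureTheory.Measure.ext_of_integral_toCircle_pow {μ ν : Measure UnitAddCircle}
    [IsFiniteMeasure μ] [IsFiniteMeasure ν]
    (h : ∀ j : ℕ, ∫ t, (toCircle t : ℂ) ^ j ∂μ = ∫ t, (toCircle t : ℂ) ^ j ∂ν) : μ = ν := by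
  obtain ⟨L, hL⟩ := exists_integralCLM μ
  obtain ⟨L', hL'⟩ := exists_integralCLM ν
  have hnat : ∀ j : ℕ, L (fourier j) = L' (fourier j) := fun j => by
    rw [hL, hL']
    simpa only [fourier_apply, natCast_zsmul, toCircle_nsmul, Circle.coe_pow] using h j
  -- Positive measures have conjugate-symmetric Fourier coefficients, so the nonnegative indices
  -- suffice.
  have hall : ∀ j : ℤ, L (fourier j) = L' (fourier j) := by
    intro j
    rcases Int.eq_nat_or_neg j with ⟨n, rfl | rfl⟩
    · exact hnat n
    · have := congrArg (starRingEnd ℂ) (hnat n)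
      rw [hL, hL', ← integral_conj, ← integral_conj] at this
      rw [hL, hL']
      simpa only [fourier_neg] using this
  have hLL : ∀ f, L f = L' f := by
    have h1 : Submodule.span ℂ (Set.range (fourier (T := (1 : ℝ)))) ≤
        LinearMap.ker (L - L').toLinearMap := by
      rw [Submodule.span_le]
      rintro _ ⟨j, rfl⟩
      simp [hall j]
    have h2 := Submodule.topologicalClosure_minimal _ h1 (L - L').isClosed_ker
    rw [span_fourier_closure_eq_top] at h2
    intro f
    have := h2 (Submodule.mem_top (x := f))
    simpa [sub_eq_zero] using this
  refine ext_of_forall_integral_eq_of_IsFiniteMeasure fun f => ?_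
  have := hLL ⟨fun t => (f t : ℂ), by fun_prop⟩
  rw [hL, hL'] at this
  simp only [ContinuousMap.coe_mk] at this
  rw [integral_complex_ofReal, integral_complex_ofReal] at this
  exact_mod_cast this

/-! ### Composition with a finite Blaschke product -/

theorem IsHInfty.pow {φ : ℂ → ℂ} (hφ : IsHInfty φ) (j : ℕ) : IsHInfty fun z => φ z ^ j := by
  induction j with
  | zero => simpa using IsHInfty.const 1
  | succ j ih => simpa only [pow_succ] using ih.mul hφ

theorem HasRadialLimit.pow {φ : ℂ → ℂ} {t : UnitAddCircle} {l : ℂ} (h : HasRadialLimit φ t l)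
    (j : ℕ) : HasRadialLimit (fun z => φ z ^ j) t (l ^ j) :=
  Tendsto.pow h j

theorem IsFiniteBlaschke.isHInfty {n : ℕ} {B : ℂ → ℂ} (hB : IsFiniteBlaschke n B) : IsHInfty B :=
  hB.isInnerOfDegree.isometric.1

/-- The action of a finite Blaschke product on the circle. -/
theorem IsFiniteBlaschke.exists_circle_map {n : ℕ} {B : ℂ → ℂ} (hB : IsFiniteBlaschke n B) :
    ∃ β : UnitAddCircle → UnitAddCircle, Continuous β ∧
      ∀ t, HasRadialLimit B t (toCircle (β t) : ℂ) := by
  obtain ⟨c, α, hc, hα, hB⟩ := hB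
  set b : ℂ → ℂ := fun z => c * ∏ j, blaschkeFactor (α j) z with hb
  have hcont : ∀ t : UnitAddCircle, ContinuousAt b (toCircle t : ℂ) := by
    intro t
    refine continuousAt_const.mul (tendsto_finsetProd _ fun j _ => ?_)
    have h0 := one_sub_conj_mul_ne_zero (hα j) (Circle.norm_coe (toCircle t)).le
    have : ContinuousAt (fun z => (z - α j) / (1 - (starRingEnd ℂ) (α j) * z)) (toCircle t : ℂ) :=
      ContinuousAt.div (by fun_prop) (by fun_prop) h0
    exact this
  have hnorm : ∀ t : UnitAddCircle, b (toCircle t : ℂ) ∈ Submonoid.unitSphere ℂ := by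
    intro t
    refine mem_sphere_zero_iff_norm.2 ?_
    rw [hb, norm_mul, hc, one_mul, norm_prod]
    exact Finset.prod_eq_one fun j _ =>
      norm_blaschkeFactor_eq (hα j) (Circle.norm_coe (toCircle t))
  let e : UnitAddCircle ≃ₜ Circle := AddCircle.homeomorphCircle one_ne_zero
  have he : ∀ x, toCircle (e.symm x) = x := fun x => by
    have := e.apply_symm_apply x
    rwa [AddCircle.homeomorphCircle_apply] at this
  obtain ⟨γ, hγc, hγ⟩ : ∃ γ : UnitAddCircle → Circle, Continuous γ ∧
      ∀ t, (γ t : ℂ) = b (toCircle t : ℂ) := by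
    refine ⟨fun t => ⟨b (toCircle t : ℂ), hnorm t⟩, Continuous.subtype_mk ?_ _, fun t => rfl⟩
    exact continuous_iff_continuousAt.2 fun t =>
      ContinuousAt.comp (f := fun t : UnitAddCircle => (toCircle t : ℂ)) (hcont t)
        continuous_toCircle_coe.continuousAt
  refine ⟨fun t => e.symm (γ t), e.symm.continuous.comp hγc, fun t => ?_⟩
  simp only
  rw [he, hγ]
  exact (HasRadialLimit.of_continuousAt (hcont t)).congr hB

/-- `B` maps the disk to itself and its boundary map `β` transports harmonic measures to harmonic
measures. -/
structure TransportsHarmonicMeasure (B : ℂ → ℂ) (β : UnitAddCircle → UnitAddCircle) : Prop where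
  isHInfty : IsHInfty B
  norm_lt_one : ∀ {z : ℂ}, ‖z‖ < 1 → ‖B z‖ < 1
  continuous : Continuous β
  map_eq : ∀ {z : ℂ}, ‖z‖ < 1 → (poissonMeasure z).map β = poissonMeasure (B z)

/-- Both measures have `j`-th moment `B(z)^j`: for the pushforward this is the Poisson formula for
`B^j` at `z`, for the harmonic measure at `B z` it is the Poisson formula for `z^j`. -/
theorem IsFiniteBlaschke.exists_transportsHarmonicMeasure {n : ℕ} {B : ℂ → ℂ}
    (hB : IsFiniteBlaschke n B) (hn : 1 ≤ n) : ∃ β, TransportsHarmonicMeasure B β := by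
  obtain ⟨β, hβ, hBβ⟩ := hB.exists_circle_map
  refine ⟨β, hB.isHInfty, hB.norm_lt_one hn, hβ, fun {z} hz => ?_⟩
  have hBz := hB.norm_lt_one hn hz
  have := isFiniteMeasure_poissonMeasure hz
  have := isFiniteMeasure_poissonMeasure hBz
  refine Measure.ext_of_integral_toCircle_pow fun j => ?_
  have hc : Continuous fun t : UnitAddCircle => (toCircle t : ℂ) ^ j := continuous_toCircle_coe.pow j
  refine (integral_map hβ.aemeasurable hc.aestronglyMeasurable).trans ?_
  rw [integral_poissonMeasure hz, integral_poissonMeasure hBz]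
  refine ((hB.isHInfty.pow j).eq_integral_poisson (Eventually.of_forall fun t =>
    (hBβ t).pow j) hz).symm.trans ?_
  exact (IsHInfty.id.pow j).eq_integral_poisson (Eventually.of_forall fun t =>
      (HasRadialLimit.of_continuousAt continuousAt_id).pow j) hBz

namespace TransportsHarmonicMeasure

variable {B : ℂ → ℂ} {β : UnitAddCircle → UnitAddCircle}

/-- At `z = 0` the transport rule says that `β` pushes arc length to a measure with a density, so
preimages of null sets under `β` are null. -/
theorem ae_comp (hB : TransportsHarmonicMeasure B β) {p : UnitAddCircle → Prop} (hp : ∀ᵐ t ∂haarAddCircle, p t) :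
    ∀ᵐ t ∂haarAddCircle, p (β t) := by
  have h := hB.map_eq (z := 0) (by simp)
  rw [poissonMeasure_zero] at h
  refine ae_of_ae_map hB.continuous.aemeasurable ?_
  rw [h]
  exact (withDensity_absolutelyContinuous _ _).ae_le hp

theorem integrable_comp (hB : TransportsHarmonicMeasure B β) {E : Type*} [NormedAddCommGroup E] [NormedSpace ℝ E]
    {k : UnitAddCircle → E} (hk : Integrable k haarAddCircle) :
    Integrable (k ∘ β) haarAddCircle := by
  have h := hB.map_eq (z := 0) (by simp)
  rw [poissonMeasure_zero] at h
  have h1 := (integrable_poissonMeasure_iff (hB.norm_lt_one (z := 0) (by simp))).2 hk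
  rw [← h] at h1
  exact h1.comp_aemeasurable hB.continuous.aemeasurable

theorem integral_poisson_comp (hB : TransportsHarmonicMeasure B β) {E : Type*} [NormedAddCommGroup E] [NormedSpace ℝ E]
    {k : UnitAddCircle → E} (hk : Integrable k haarAddCircle) {z : ℂ} (hz : ‖z‖ < 1) :
    ∫ t, poisson (B z) t • k t ∂haarAddCircle = ∫ t, poisson z t • k (β t) ∂haarAddCircle := by
  have h := hB.map_eq hz
  have hBz := hB.norm_lt_one hz
  rw [← integral_poissonMeasure hz, ← integral_poissonMeasure hBz, ← h, integral_map hB.continuous.aemeasurable]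
  rw [h]
  exact ((integrable_poissonMeasure_iff hBz).2 hk).aestronglyMeasurable

/-- `B` need not map radii to radii, so a radial limit of `φ` at `β t` would not suffice by itself.
Instead `φ ∘ B` is the Poisson integral of `F ∘ β`, and Fatou's theorem applies to it directly. -/
theorem hasRadialLimit_comp (hB : TransportsHarmonicMeasure B β) {φ : ℂ → ℂ}
    {F : UnitAddCircle → ℂ}
    (hF : Integrable F haarAddCircle)
    (hφF : ∀ z : ℂ, ‖z‖ < 1 → φ z = ∫ t, poisson z t • F t ∂haarAddCircle) :
    ∀ᵐ t ∂haarAddCircle, HasRadialLimit (φ ∘ B) t (F (β t)) := by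
  filter_upwards [ae_tendsto_integral_poisson (hB.integrable_comp hF)]
    with t ht
  refine Tendsto.congr' ?_ ht
  filter_upwards [eventually_radial_mem_ball t] with r hr
  have hr : ‖(r : ℂ) * (toCircle t : ℂ)‖ < 1 := by simpa using hr
  simp only [Function.comp_apply]
  rw [hφF _ (hB.norm_lt_one hr), hB.integral_poisson_comp hF hr]

end TransportsHarmonicMeasure

/-! ### Outer functions -/

/-- The outer function with logarithmic boundary modulus `k`, positive at the origin. -/
noncomputable def outerFun (k : UnitAddCircle → ℝ) (z : ℂ) : ℂ :=
  Complex.exp (∫ t, herglotz z t * (k t : ℂ) ∂haarAddCircle)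

theorem isOuter_iff {φ : ℂ → ℂ} :
    IsOuter φ ↔ ∃ (c : ℂ) (k : UnitAddCircle → ℝ), ‖c‖ = 1 ∧ Integrable k haarAddCircle ∧
      ∀ z ∈ Metric.ball (0 : ℂ) 1, φ z = c * outerFun k z := Iff.rfl

theorem outerFun_ne_zero (k : UnitAddCircle → ℝ) (z : ℂ) : outerFun k z ≠ 0 :=
  Complex.exp_ne_zero _

theorem outerFun_congr {k l : UnitAddCircle → ℝ} (h : k =ᵐ[haarAddCircle] l) :
    outerFun k = outerFun l := by
  funext z
  rw [outerFun, outerFun]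
  congr 1
  refine integral_congr_ae ?_
  filter_upwards [h] with t ht
  rw [ht]

theorem norm_outerFun {k : UnitAddCircle → ℝ} (hk : Integrable k haarAddCircle) {z : ℂ}
    (hz : ‖z‖ < 1) : ‖outerFun k z‖ = Real.exp (∫ t, poisson z t * k t ∂haarAddCircle) := by
  rw [outerFun, Complex.norm_exp, re_integral_herglotz hk hz]

theorem outerFun_sub {k l : UnitAddCircle → ℝ} (hk : Integrable k haarAddCircle)
    (hl : Integrable l haarAddCircle) {z : ℂ} (hz : ‖z‖ < 1) :
    outerFun (fun t => k t - l t) z = outerFun k z / outerFun l z := by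
  have hk' : Integrable (fun t => (k t : ℂ)) haarAddCircle := hk.ofReal
  have hl' : Integrable (fun t => (l t : ℂ)) haarAddCircle := hl.ofReal
  rw [outerFun, outerFun, outerFun, ← Complex.exp_sub]
  congr 1
  rw [← integral_sub (hk'.continuous_mul_addCircle (continuous_herglotz hz))
    (hl'.continuous_mul_addCircle (continuous_herglotz hz))]
  simp only [Complex.ofReal_sub, mul_sub]

theorem outerFun_neg (k : UnitAddCircle → ℝ) (z : ℂ) :
    outerFun (fun t => -k t) z = (outerFun k z)⁻¹ := by
  rw [outerFun, outerFun, ← Complex.exp_neg, ← integral_neg]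
  simp only [Complex.ofReal_neg, mul_neg]

theorem differentiableOn_outerFun {k : UnitAddCircle → ℝ} (hk : Integrable k haarAddCircle) :
    DifferentiableOn ℂ (outerFun k) (Metric.ball 0 1) :=
  have hk' : Integrable (fun t => (k t : ℂ)) haarAddCircle := hk.ofReal
  (differentiableOn_integral_herglotz hk').cexp

theorem outerFun_zero_pos (k : UnitAddCircle → ℝ) : ∃ x : ℝ, 0 < x ∧ outerFun k 0 = (x : ℂ) := by
  refine ⟨Real.exp (∫ t, k t ∂haarAddCircle), Real.exp_pos _, ?_⟩
  have h : ∀ t, herglotz 0 t = 1 := fun t => by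
    have := toCircle_sub_ne_zero (z := 0) (by simp) t
    rw [herglotz, add_zero]
    rw [sub_zero] at this ⊢
    exact div_self this
  rw [outerFun, Complex.ofReal_exp, ← integral_complex_ofReal]
  simp only [h, one_mul]

theorem integrable_poisson_mul {k : UnitAddCircle → ℝ} (hk : Integrable k haarAddCircle) {z : ℂ}
    (hz : ‖z‖ < 1) : Integrable (fun t => poisson z t * k t) haarAddCircle :=
  hk.continuous_smul_addCircle (continuous_poisson hz)

theorem norm_outerFun_le {k : UnitAddCircle → ℝ} (hk : Integrable k haarAddCircle) {M : ℝ}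
    (hM : ∀ᵐ t ∂haarAddCircle, k t ≤ M) {z : ℂ} (hz : ‖z‖ < 1) :
    ‖outerFun k z‖ ≤ Real.exp M := by
  rw [norm_outerFun hk hz, Real.exp_le_exp]
  calc _ ≤ ∫ t, poisson z t * M ∂haarAddCircle := by
        refine integral_mono_ae (integrable_poisson_mul hk hz)
          (integrable_poisson_mul (integrable_const M) hz) ?_
        filter_upwards [hM] with t ht
        exact mul_le_mul_of_nonneg_left ht (poisson_pos hz t).le
    _ = M := by rw [integral_mul_const, integral_poisson hz, one_mul]

theorem isHInfty_outerFun {k : UnitAddCircle → ℝ} (hk : Integrable k haarAddCircle) {M : ℝ}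
    (hM : ∀ᵐ t ∂haarAddCircle, k t ≤ M) : IsHInfty (outerFun k) :=
  ⟨differentiableOn_outerFun hk, _, fun _ hz => norm_outerFun_le hk hM (by simpa using hz)⟩

theorem ae_tendsto_norm_outerFun {k : UnitAddCircle → ℝ} (hk : Integrable k haarAddCircle) :
    ∀ᵐ t ∂haarAddCircle, Tendsto (fun r : ℝ => ‖outerFun k (r * (toCircle t : ℂ))‖) (𝓝[<] 1)
      (𝓝 (Real.exp (k t))) := by
  filter_upwards [ae_tendsto_integral_poisson hk] with t ht
  refine Tendsto.congr' ?_ (Real.continuous_exp.continuousAt.tendsto.comp ht)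
  filter_upwards [eventually_radial_mem_ball t] with r hr
  exact (norm_outerFun hk (by simpa using hr)).symm

/-- The modulus of an outer function is the exponential of a Poisson integral, so Fatou's theorem
identifies `k` as the logarithm of the boundary modulus. -/
theorem ae_norm_eq_exp_of_hasRadialLimit {φ : ℂ → ℂ} {c : ℂ} {k : UnitAddCircle → ℝ} (hc : ‖c‖ = 1)
    (hk : Integrable k haarAddCircle)
    (h : ∀ z ∈ Metric.ball (0 : ℂ) 1, φ z = c * outerFun k z) :
    ∀ᵐ t ∂haarAddCircle, ∀ l, HasRadialLimit φ t l → ‖l‖ = Real.exp (k t) := by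
  filter_upwards [ae_tendsto_norm_outerFun hk] with t ht l hl
  refine tendsto_nhds_unique (Tendsto.norm hl) (Tendsto.congr' ?_ ht)
  filter_upwards [eventually_radial_mem_ball t] with r hr
  rw [h _ hr, norm_mul, hc, one_mul]

/-- A bounded analytic function is dominated by every outer function that dominates it on the
boundary. -/
theorem IsHInfty.norm_le_norm_outerFun {u : ℂ → ℂ} (hu : IsHInfty u) {L : UnitAddCircle → ℝ}
    (hL : Integrable L haarAddCircle)
    (huL : ∀ᵐ t ∂haarAddCircle, ∃ l, HasRadialLimit u t l ∧ ‖l‖ ≤ Real.exp (L t)) {z : ℂ}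
    (hz : ‖z‖ < 1) : ‖u z‖ ≤ ‖outerFun L z‖ := by
  -- The inverse of the outer function of `L` may be unbounded. Truncation from below makes the
  -- inverse bounded by `e^N`, so the maximum principle applies to its product with `u`; then `N →
  -- ∞` by dominated convergence.
  let K : ℕ → UnitAddCircle → ℝ := fun N t => max (L t) (-N)
  have hKabs : ∀ N t, ‖K N t‖ ≤ ‖L t‖ := by
    intro N t
    simp only [K, Real.norm_eq_abs]
    have hN : (0 : ℝ) ≤ N := N.cast_nonneg
    rcases le_total (L t) (-N) with h | h
    · rw [max_eq_right h, abs_neg, abs_of_nonneg hN]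
      exact (by linarith : (N : ℝ) ≤ -L t).trans (neg_le_abs _)
    · rw [max_eq_left h]
  have hKm : ∀ N, AEStronglyMeasurable (K N) haarAddCircle := fun N =>
    hL.aestronglyMeasurable.sup aestronglyMeasurable_const
  have hK : ∀ N, Integrable (K N) haarAddCircle := fun N =>
    hL.mono (hKm N) (Eventually.of_forall (hKabs N))
  have hle : ∀ N, ‖u z‖ ≤ Real.exp (∫ t, poisson z t * K N t ∂haarAddCircle) := by
    intro N
    have hKn : Integrable (fun t => -K N t) haarAddCircle := (hK N).neg
    have h1 : IsHInfty (outerFun fun t => -K N t) := isHInfty_outerFun hKn (M := N)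
      (Eventually.of_forall fun t => neg_le.1 (le_max_right _ _))
    obtain ⟨F, -, -, hF⟩ := h1.exists_boundary
    have h2 := (hu.mul h1).norm_le_of_ae (M := 1) (by
      filter_upwards [huL, hF, ae_norm_eq_exp_of_hasRadialLimit (c := 1) norm_one hKn
        fun z _ => (one_mul _).symm] with t ⟨l, hl, hlL⟩ hF' hn
      refine ⟨l * F t, Tendsto.mul hl hF', ?_⟩
      rw [norm_mul, hn _ hF']
      calc _ ≤ Real.exp (L t) * Real.exp (-K N t) := by gcongr
        _ ≤ 1 := by
          rw [← Real.exp_add, Real.exp_le_one_iff]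
          linarith [le_max_left (L t) (-N : ℝ)]) hz
    rw [norm_mul, outerFun_neg, norm_inv, ← div_eq_mul_inv,
      div_le_one (norm_pos_iff.2 (outerFun_ne_zero _ _)), norm_outerFun (hK N) hz] at h2
    exact h2
  rw [norm_outerFun hL hz]
  refine ge_of_tendsto' (x := atTop) ((Real.continuous_exp.tendsto _).comp ?_) hle
  refine tendsto_integral_of_dominated_convergence (fun t => ‖poisson z t * L t‖)
    (fun N => (integrable_poisson_mul (hK N) hz).aestronglyMeasurable)
    (integrable_poisson_mul hL hz).norm (fun N => Eventually.of_forall fun t => ?_)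
    (Eventually.of_forall fun t => ?_)
  · rw [norm_mul, norm_mul]
    gcongr
    exact hKabs N t
  · refine Tendsto.const_mul _ (tendsto_const_nhds.congr' ?_)
    obtain ⟨N₀, hN₀⟩ := exists_nat_ge (-L t)
    filter_upwards [eventually_ge_atTop N₀] with N hN
    have : (N₀ : ℝ) ≤ N := by exact_mod_cast hN
    exact (max_eq_left (by linarith)).symm

/-- The modulus attains its maximum at the interior point `0`, so the maximum principle forces `f`
to be constant. -/
theorem eq_of_norm_eq_one {f : ℂ → ℂ} (hf : DifferentiableOn ℂ f (Metric.ball 0 1))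
    (h1 : ∀ z ∈ Metric.ball (0 : ℂ) 1, ‖f z‖ = 1) {z : ℂ} (hz : z ∈ Metric.ball (0 : ℂ) 1) :
    f z = f 0 := by
  have h0 : (0 : ℂ) ∈ Metric.ball (0 : ℂ) 1 := by simp
  refine Complex.eqOn_of_isPreconnected_of_isMaxOn_norm
    (convex_ball (0 : ℂ) 1).isPreconnected Metric.isOpen_ball hf h0 (fun w hw => ?_) hz
  simp only [Function.comp_apply, Set.mem_ofPred_eq, h1 w hw, h1 0 h0, le_refl]

theorem TransportsHarmonicMeasure.mapsTo {B : ℂ → ℂ} {β : UnitAddCircle → UnitAddCircle}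
    (hB : TransportsHarmonicMeasure B β) :
    Set.MapsTo B (Metric.ball 0 1) (Metric.ball 0 1) := fun z hz => by
  rw [mem_ball_zero_iff] at hz ⊢
  exact hB.norm_lt_one hz

/-- Outer functions are stable under composition with finite Blaschke products. -/
theorem IsOuter.comp {B : ℂ → ℂ} {β : UnitAddCircle → UnitAddCircle}
    (hB : TransportsHarmonicMeasure B β) {φ : ℂ → ℂ} (hφ : IsOuter φ) : IsOuter (φ ∘ B) := by
  obtain ⟨c, k, hc, hk, h⟩ := isOuter_iff.1 hφ
  have hkβ := hB.integrable_comp hk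
  -- By transport of harmonic measure, numerator and denominator have the same modulus on the disk,
  -- so the quotient is a unimodular constant. Only moduli, hence Poisson integrals, need to be
  -- compared.
  let q : ℂ → ℂ := fun z => outerFun k (B z) / outerFun (k ∘ β) z
  have hq : DifferentiableOn ℂ q (Metric.ball 0 1) :=
    ((differentiableOn_outerFun hk).comp hB.isHInfty.1 hB.mapsTo).div
      (differentiableOn_outerFun hkβ) fun z _ => outerFun_ne_zero _ z
  have hq1 : ∀ z ∈ Metric.ball (0 : ℂ) 1, ‖q z‖ = 1 := by
    intro z hz
    rw [mem_ball_zero_iff] at hz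
    rw [norm_div, div_eq_one_iff_eq (norm_ne_zero_iff.2 (outerFun_ne_zero _ _)),
      norm_outerFun hk (hB.norm_lt_one hz), norm_outerFun hkβ hz]
    congr 1
    exact hB.integral_poisson_comp hk hz
  refine isOuter_iff.2 ⟨c * q 0, k ∘ β, ?_, hkβ, fun z hz => ?_⟩
  · rw [norm_mul, hc, hq1 0 (by simp), one_mul]
  · rw [← eq_of_norm_eq_one hq hq1 hz, Function.comp_apply, h _ (hB.mapsTo hz), mul_assoc]
    simp only [q]
    rw [div_mul_cancel₀ _ (outerFun_ne_zero _ _)]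

theorem IsOuter.const_mul {e : ℂ} (he : ‖e‖ = 1) {φ : ℂ → ℂ} (hφ : IsOuter φ) :
    IsOuter fun z => e * φ z := by
  obtain ⟨c, k, hc, hk, h⟩ := isOuter_iff.1 hφ
  exact isOuter_iff.2 ⟨e * c, k, by rw [norm_mul, he, hc, one_mul], hk, fun z hz => by
    rw [h z hz, mul_assoc]⟩

/-! ### Canonical representations -/

/-- Every Smirnov function has a canonical representation. -/
theorem IsSmirnov.exists_isCanonicalPair {g : ℂ → ℂ} (hg : IsSmirnov g) :
    ∃ a b : ℂ → ℂ, IsCanonicalPair g a b := by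
  obtain ⟨u, v, hu, hv, hvo, hguv⟩ := hg
  obtain ⟨c, k, hc, hk, hvk⟩ := isOuter_iff.1 hvo
  have hc0 : c ≠ 0 := fun h => by simp [h] at hc
  obtain ⟨Fu, hFu, -, huF⟩ := hu.exists_boundary
  obtain ⟨Fv, hFv, -, hvF⟩ := hv.exists_boundary
  have hbdd : ∀ {φ : ℂ → ℂ} {t l}, HasRadialLimit φ t l → ∀ M : ℝ,
      (∀ z ∈ Metric.ball (0 : ℂ) 1, ‖φ z‖ ≤ M) → ‖l‖ ≤ M := by
    intro φ t l h M hM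
    refine le_of_tendsto (Tendsto.norm h) ?_
    filter_upwards [eventually_radial_mem_ball t] with r hr using hM _ hr
  obtain ⟨Mu, hMu⟩ := hu.2
  obtain ⟨Mv, hMv⟩ := hv.2
  -- `S` is `|u|² + |v|²` on the boundary and `exp L` is its square root. Dividing `u` and `v` by
  -- the outer function of `L` normalizes the sum of squares to `1`.
  let S : UnitAddCircle → ℝ := fun t => ‖Fu t‖ ^ 2 + Real.exp (k t) ^ 2
  have hS : ∀ t, 0 < S t := fun t => by positivity
  let L : UnitAddCircle → ℝ := fun t => Real.log (S t) / 2
  have hexpL : ∀ t, Real.exp (L t) ^ 2 = S t := fun t => by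
    rw [← Real.exp_nat_mul, Nat.cast_two, mul_div_cancel₀ _ two_ne_zero, Real.exp_log (hS t)]
  have hkL : ∀ t, k t ≤ L t := fun t => by
    rw [← Real.exp_le_exp, ← pow_le_pow_iff_left₀ (Real.exp_pos _).le (Real.exp_pos _).le
      two_ne_zero, hexpL]
    exact le_add_of_nonneg_left (by positivity)
  have huL : ∀ t, ‖Fu t‖ ≤ Real.exp (L t) := fun t => by
    rw [← pow_le_pow_iff_left₀ (norm_nonneg _) (Real.exp_pos _).le two_ne_zero, hexpL]
    exact le_add_of_nonneg_right (by positivity)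
  have hk1 := ae_norm_eq_exp_of_hasRadialLimit hc hk hvk
  have hLint : Integrable L haarAddCircle := by
    have hm : AEStronglyMeasurable L haarAddCircle := by
      have h1 := hFu.aestronglyMeasurable.norm.aemeasurable
      have h2 := hk.aestronglyMeasurable.aemeasurable
      exact (((h1.pow_const 2).add (h2.exp.pow_const 2)).log.div_const 2).aestronglyMeasurable
    -- `L` lies between `k` and a constant: from below `S ≥ exp (2 k)`, from above `log S ≤ S - 1`
    -- and `S` is bounded. So the integrability of `log |v|` is all that is needed.
    refine Integrable.mono' (hk.norm.add (integrable_const (Mu ^ 2 + Mv ^ 2))) hm ?_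
    filter_upwards [huF, hvF, hk1] with t h1 h2 h3
    have h4 := hbdd h1 Mu hMu
    have h5 := hbdd h2 Mv hMv
    rw [h3 _ h2] at h5
    have h6 : ‖Fu t‖ ^ 2 ≤ Mu ^ 2 := by gcongr
    have h7 : Real.exp (k t) ^ 2 ≤ Mv ^ 2 := by gcongr
    have h8 : L t ≤ Mu ^ 2 + Mv ^ 2 := by
      have := Real.log_le_sub_one_of_pos (hS t)
      have h9 : S t ≤ Mu ^ 2 + Mv ^ 2 := add_le_add h6 h7
      simp only [L]
      linarith [hS t]
    rw [Pi.add_apply, Real.norm_eq_abs, Real.norm_eq_abs, abs_le]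
    constructor
    · linarith [hkL t, neg_abs_le (k t), sq_nonneg Mu, sq_nonneg Mv]
    · linarith [abs_nonneg (k t)]
  have hdom : ∀ z : ℂ, ‖z‖ < 1 → ‖u z‖ ≤ ‖outerFun L z‖ := fun z hz =>
    hu.norm_le_norm_outerFun hLint (by
      filter_upwards [huF] with t ht using ⟨_, ht, huL t⟩) hz
  have hkLint : Integrable (fun t => k t - L t) haarAddCircle := hk.sub hLint
  have ha : IsHInfty (outerFun fun t => k t - L t) := isHInfty_outerFun hkLint (M := 0)
    (Eventually.of_forall fun t => sub_nonpos.2 (hkL t))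
  -- The unimodular constant of `v` is moved into `b`, which leaves the denominator positive at the
  -- origin.
  let b : ℂ → ℂ := fun z => c⁻¹ * (u z / outerFun L z)
  have hbn : ∀ z, ‖b z‖ = ‖u z‖ / ‖outerFun L z‖ := fun z => by
    simp only [b]
    rw [norm_mul, norm_inv, hc, inv_one, one_mul, norm_div]
  have hb : IsHInfty b := by
    refine ⟨(hu.1.div (differentiableOn_outerFun hLint) fun z _ =>
      outerFun_ne_zero _ z).const_mul _, 1, fun z hz => ?_⟩
    rw [hbn, div_le_one (norm_pos_iff.2 (outerFun_ne_zero _ _))]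
    exact hdom z (by simpa using hz)
  refine ⟨outerFun fun t => k t - L t, b, ha, hb,
    isOuter_iff.2 ⟨1, _, norm_one, hkLint, fun z _ => (one_mul _).symm⟩, outerFun_zero_pos _, ?_, ?_⟩
  · obtain ⟨Fa, -, -, haF⟩ := ha.exists_boundary
    obtain ⟨Fb, -, -, hbF⟩ := hb.exists_boundary
    filter_upwards [haF, hbF, huF, ae_tendsto_norm_outerFun hLint,
      ae_norm_eq_exp_of_hasRadialLimit (c := 1) norm_one hkLint fun z _ => (one_mul _).symm]
      with t h1 h2 h3 h4 h5
    refine ⟨Fa t, Fb t, h1, h2, ?_⟩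
    have h6 : ‖Fb t‖ = ‖Fu t‖ / Real.exp (L t) := by
      refine tendsto_nhds_unique (Tendsto.norm h2) ?_
      simp only [hbn]
      exact Tendsto.div (Tendsto.norm h3) h4 (Real.exp_pos _).ne'
    rw [h5 _ h1, h6, Real.exp_sub, div_pow, div_pow, ← add_div, hexpL, add_comm]
    exact div_self (hS t).ne'
  · intro z hz
    have h0 := outerFun_ne_zero k z
    have h1 := outerFun_ne_zero L z
    rw [hguv z hz, hvk z hz, outerFun_sub hk hLint (by simpa using hz)]
    simp only [b]
    field_simp

/-- The canonical representation of `g ∘ B`. -/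
theorem IsCanonicalPair.exists_comp {g a b : ℂ → ℂ} (hp : IsCanonicalPair g a b) {B : ℂ → ℂ}
    {β : UnitAddCircle → UnitAddCircle} (hB : TransportsHarmonicMeasure B β) :
    ∃ e : ℂ, ‖e‖ = 1 ∧ IsCanonicalPair (g ∘ B) (fun z => e * a (B z)) fun z => e * b (B z) := by
  have ha0 : a (B 0) ≠ 0 := hp.outer_a.ne_zero (hB.norm_lt_one (by simp))
  have hn0 : ‖a (B 0)‖ ≠ 0 := norm_ne_zero_iff.2 ha0
  -- The factor rotates `a (B 0)` to its modulus, restoring the normalization at the origin that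
  -- composition with `B` may destroy.
  have he : ‖(starRingEnd ℂ) (a (B 0)) / (‖a (B 0)‖ : ℂ)‖ = 1 := by
    rw [norm_div, Complex.norm_conj, Complex.norm_real, norm_norm, div_self hn0]
  refine ⟨(starRingEnd ℂ) (a (B 0)) / (‖a (B 0)‖ : ℂ), he, ?_⟩
  set e := (starRingEnd ℂ) (a (B 0)) / (‖a (B 0)‖ : ℂ) with hedef
  have he0 : e ≠ 0 := fun h => by simp [h] at he
  have hB1 : ∀ z ∈ Metric.ball (0 : ℂ) 1, ‖B z‖ < 1 := fun z hz => by simpa using hB.mapsTo hz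
  refine ⟨(IsHInfty.const e).mul (hp.hInfty_a.comp hB.isHInfty hB1),
    (IsHInfty.const e).mul (hp.hInfty_b.comp hB.isHInfty hB1),
    (hp.outer_a.comp hB).const_mul he, ⟨‖a (B 0)‖, norm_pos_iff.2 ha0, ?_⟩, ?_, fun z hz => ?_⟩
  · rw [hedef, div_mul_eq_mul_div, Complex.conj_mul', pow_two, mul_div_assoc,
      div_self (by exact_mod_cast hn0), mul_one]
  · obtain ⟨Fa, hFa, ha, haF⟩ := hp.hInfty_a.exists_boundary
    obtain ⟨Fb, hFb, hb, hbF⟩ := hp.hInfty_b.exists_boundary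
    have h1 : ∀ᵐ t ∂haarAddCircle, ‖Fa t‖ ^ 2 + ‖Fb t‖ ^ 2 = 1 := by
      filter_upwards [hp.sq_add_sq, haF, hbF] with t ⟨α, γ, h1, h2, h3⟩ h4 h5
      rw [tendsto_nhds_unique h4 h1, tendsto_nhds_unique h5 h2, h3]
    filter_upwards [hB.ae_comp h1, hB.hasRadialLimit_comp hFa ha, hB.hasRadialLimit_comp hFb hb]
      with t h2 h3 h4
    refine ⟨e * Fa (β t), e * Fb (β t), Tendsto.const_mul e h3, Tendsto.const_mul e h4, ?_⟩
    rw [norm_mul, norm_mul, he, one_mul, one_mul, h2]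
  · rw [Function.comp_apply, hp.eq_div _ (hB.mapsTo hz), mul_div_mul_left _ _ he0]

/-- The denominator of the canonical representation is unique. -/
theorem IsCanonicalPair.exists_eq_mul {g a b a' b' : ℂ → ℂ} (hp : IsCanonicalPair g a b)
    (hp' : IsCanonicalPair g a' b') :
    ∃ e : ℂ, ‖e‖ = 1 ∧ ∀ z ∈ Metric.ball (0 : ℂ) 1, a' z = e * a z := by
  obtain ⟨c, k, hc, hk, h⟩ := isOuter_iff.1 hp.outer_a
  obtain ⟨c', k', hc', hk', h'⟩ := isOuter_iff.1 hp'.outer_a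
  have hkk : k' =ᵐ[haarAddCircle] k := by
    filter_upwards [hp.sq_add_sq, hp'.sq_add_sq, ae_norm_eq_exp_of_hasRadialLimit hc hk h,
      ae_norm_eq_exp_of_hasRadialLimit hc' hk' h'] with t ⟨α, γ, h1, h2, h3⟩ ⟨α', γ', h1', h2', h3'⟩
      h4 h4'
    have h5 : γ * α' = γ' * α := by
      refine tendsto_nhds_unique (Tendsto.mul h2 h1') (Tendsto.congr' ?_ (Tendsto.mul h2' h1))
      filter_upwards [eventually_radial_mem_ball t] with r hr
      have e1 := hp.eq_div _ hr
      rw [hp'.eq_div _ hr, div_eq_div_iff (hp'.outer_a.ne_zero (by simpa using hr))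
        (hp.outer_a.ne_zero (by simpa using hr))] at e1
      exact e1
    have h6 : ‖γ‖ ^ 2 * ‖α'‖ ^ 2 = ‖γ'‖ ^ 2 * ‖α‖ ^ 2 := by
      rw [← mul_pow, ← mul_pow, ← norm_mul, ← norm_mul, h5]
    -- With `|γ|² = 1 - |α|²` and `|γ'|² = 1 - |α'|²` the products `|α|² |α'|²` cancel. The quotient
    -- thus determines the boundary modulus of the denominator, even where that modulus might be
    -- zero.
    have h7 : ‖α'‖ ^ 2 = ‖α‖ ^ 2 := by
      rw [← eq_sub_iff_add_eq'] at h3 h3'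
      rw [h3, h3'] at h6
      linarith
    have h8 := (pow_left_inj₀ (norm_nonneg _) (norm_nonneg _) two_ne_zero).1 h7
    rw [h4 _ h1, h4' _ h1'] at h8
    exact Real.exp_injective h8
  have hc0 : c ≠ 0 := fun h => by simp [h] at hc
  refine ⟨c' / c, by rw [norm_div, hc, hc', div_one], fun z hz => ?_⟩
  rw [h z hz, h' z hz, outerFun_congr hkk]
  field_simp

/-! ### Intertwining the Toeplitz operators -/

theorem Hardy2.mulRange_const_mul {e : ℂ} (he : e ≠ 0) (φ : ℂ → ℂ) :
    mulRange (fun z => e * φ z) = mulRange φ := by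
  ext f
  constructor
  · rintro ⟨h, hh⟩
    exact ⟨e • h, fun z hz => by rw [hh z hz, eval_smul _ _ hz]; ring⟩
  · rintro ⟨h, hh⟩
    exact ⟨e⁻¹ • h, fun z hz => by rw [hh z hz, eval_smul _ _ hz]; field_simp⟩

theorem toeplitz_domain {g a b : ℂ → ℂ} (hp : IsCanonicalPair g a b) :
    (toeplitz hp).domain = Hardy2.mulRange a := rfl

theorem CarriesTo.symm {H K : Type*} [NormedAddCommGroup H] [InnerProductSpace ℂ H]
    [NormedAddCommGroup K] [InnerProductSpace ℂ K] {S : H →ₗ.[ℂ] H} {T : K →ₗ.[ℂ] K}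
    {U : H ≃ₗᵢ[ℂ] K} (h : CarriesTo S T U) : CarriesTo T S U.symm := by
  refine ⟨fun x => ?_, fun x y hy => ?_⟩
  · rw [h.1, U.apply_symm_apply]
  · have := h.2 y x (by rw [hy, U.apply_symm_apply])
    rw [this, U.symm_apply_apply]

/-- The unitary `(f_j) ↦ ∑ w_j (f_j ∘ B)` carries the direct sum of copies of `T_g` to
`T_{g ∘ B}`. -/
theorem carriesTo_toeplitz_comp {g a b a' b' B : ℂ → ℂ} {n : ℕ} (hp : IsCanonicalPair g a b)
    (hp' : IsCanonicalPair (g ∘ B) a' b') {β : UnitAddCircle → UnitAddCircle}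
    (hB : TransportsHarmonicMeasure B β) (w : Fin n → Hardy2)
    (U : PiLp 2 (fun _ : Fin n => Hardy2) ≃ₗᵢ[ℂ] Hardy2)
    (hU : ∀ (f : PiLp 2 (fun _ : Fin n => Hardy2)) (z : ℂ), ‖z‖ < 1 →
      Hardy2.eval (U f) z = ∑ j, Hardy2.eval (w j) z * Hardy2.eval (f j) (B z)) :
    CarriesTo (H := PiLp 2 fun _ : Fin n => Hardy2) (directSumOp n (toeplitz hp))
      (toeplitz hp') U := by
  -- The given denominator `a'` differs from `a ∘ B` only by unimodular constants, which do not
  -- affect the range.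
  have hdom : (toeplitz hp').domain = Hardy2.mulRange fun z => a (B z) := by
    obtain ⟨e, he, hpe⟩ := hp.exists_comp hB
    obtain ⟨e', he', heq⟩ := hpe.exists_eq_mul hp'
    rw [toeplitz_domain, Hardy2.mulRange_congr heq, Hardy2.mulRange_const_mul,
      Hardy2.mulRange_const_mul]
    · exact fun h => by simp [h] at he
    · exact fun h => by simp [h] at he'
  refine ⟨fun x => ?_, fun x y hy => Hardy2.ext_eval fun z hz => ?_⟩
  · rw [hdom]
    constructor
    · intro hx
      choose h hh using fun j => (show x j ∈ Hardy2.mulRange a from hx j)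
      refine ⟨U (WithLp.toLp 2 h), fun z hz => ?_⟩
      rw [hU _ z hz, hU _ z hz, Finset.mul_sum]
      refine Finset.sum_congr rfl fun j _ => ?_
      rw [hh j _ (hB.norm_lt_one hz)]
      ring
    -- Here `U x = (a ∘ B) k`. Write `k = U f`; then `(a ∘ B) U f` is `U` applied to the tuple of
    -- the `a f_j`, so injectivity of `U` gives `x_j = a f_j`.
    · rintro ⟨k, hk⟩ j
      choose h hh using fun j => Hardy2.exists_mul a hp.hInfty_a.1 hp.hInfty_a.2 (U.symm k j)
      have hx : x = WithLp.toLp 2 h := by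
        apply U.injective
        refine Hardy2.ext_eval fun z hz => ?_
        rw [hk z hz, hU _ z hz, ← U.apply_symm_apply k, hU _ z hz, Finset.mul_sum]
        refine Finset.sum_congr rfl fun j _ => ?_
        refine Eq.trans ?_ (congrArg _ (hh j _ (hB.norm_lt_one hz)).symm)
        ring
      rw [hx]
      exact ⟨_, hh j⟩
  · rw [toeplitz_eval hp' y hz, hy, hU _ z hz, hU _ z hz, Finset.mul_sum]
    refine Finset.sum_congr rfl fun j _ => ?_
    have := toeplitz_eval hp ⟨(x : PiLp 2 fun _ : Fin n => Hardy2) j, x.2 j⟩ (hB.norm_lt_one hz)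
    refine Eq.trans ?_ (congrArg _ this.symm)
    rw [Function.comp_apply]
    ring

theorem mainTheorem12 (g : ℂ → ℂ) (hg : IsRealSmirnov g) (n : ℕ) (hn : 1 ≤ n) (B : ℂ → ℂ)
    (hB : IsFiniteBlaschke n B) :
    (∃ a b : ℂ → ℂ, IsCanonicalPair g a b) ∧
    (∃ a b : ℂ → ℂ, IsCanonicalPair (g ∘ B) a b) ∧
    Module.finrank ℂ (Hardy2.mulRange B)ᗮ = n ∧
    ∀ (a b a' b' : ℂ → ℂ) (hp : IsCanonicalPair g a b) (hp' : IsCanonicalPair (g ∘ B) a' b'),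
      UnitarilyEquivalent (K := PiLp 2 fun _ : Fin n => Hardy2) (toeplitz hp')
        (directSumOp n (toeplitz hp)) ∧
      ∀ w : OrthonormalBasis (Fin n) ℂ (Hardy2.mulRange B)ᗮ,
        ∃ U : PiLp 2 (fun _ : Fin n => Hardy2) ≃ₗᵢ[ℂ] Hardy2,
          (∀ (f : PiLp 2 (fun _ : Fin n => Hardy2)) (z : ℂ), ‖z‖ < 1 →
            Hardy2.eval (U f) z = ∑ j, Hardy2.eval (w j) z * Hardy2.eval (f j) (B z)) ∧
          CarriesTo (H := PiLp 2 fun _ : Fin n => Hardy2) (directSumOp n (toeplitz hp))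
            (toeplitz hp') U := by
  obtain ⟨β, hβ⟩ := hB.exists_transportsHarmonicMeasure hn
  have hdeg := hB.isInnerOfDegree
  obtain ⟨a₀, b₀, hp₀⟩ := hg.1.exists_isCanonicalPair
  obtain ⟨e, -, hpe⟩ := hp₀.exists_comp hβ
  refine ⟨⟨a₀, b₀, hp₀⟩, ⟨_, _, hpe⟩, hdeg.finrank, fun a b a' b' hp hp' => ?_⟩
  have key : ∀ w : OrthonormalBasis (Fin n) ℂ (Hardy2.mulRange B)ᗮ,
      ∃ U : PiLp 2 (fun _ : Fin n => Hardy2) ≃ₗᵢ[ℂ] Hardy2,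
        (∀ (f : PiLp 2 (fun _ : Fin n => Hardy2)) (z : ℂ), ‖z‖ < 1 →
          Hardy2.eval (U f) z = ∑ j, Hardy2.eval (w j) z * Hardy2.eval (f j) (B z)) ∧
        CarriesTo (H := PiLp 2 fun _ : Fin n => Hardy2) (directSumOp n (toeplitz hp))
          (toeplitz hp') U := by
    intro w
    obtain ⟨U, hU⟩ := Hardy2.exists_unitary hdeg.isometric (fun z hz => hB.norm_lt_one hn hz) w
    exact ⟨U, hU, carriesTo_toeplitz_comp hp hp' hβ (fun j => w j) U hU⟩
  refine ⟨?_, key⟩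
  have := hdeg.finiteDimensional
  obtain ⟨U, -, hU⟩ := key ((stdOrthonormalBasis ℂ (Hardy2.mulRange B)ᗮ).reindex
    (finCongr hdeg.finrank))
  exact ⟨U.symm, hU.symm⟩
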